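/- Let $J\ge 1$, $\lambda>0$, $\mu_1,\dots,\mu_J>0$, and let $Q(\cdot)$ be a birth--death process on $\{0,1,\dots,J\}$ (a continuous-time Markov chain with right-continuous paths having left limits, with an arbitrary initial distribution) with constant birth rate $\lambda_i=\lambda$ for $0\le i\le J-1$ and death rates $\mu_1,\dots,\mu_J$. Let $\pi=(\pi_0,\dots,\pi_J)$ be its stationary distribution, $P_i=\sum_{j=0}^i\pi_j$, and let $N_{\rm dep}(0,t]$ be the number of deaths in $(0,t]$. Then $N_{\rm dep}(0,t]$ has a finite second moment for every $t$, the mean ${\rm E}(N_{\rm dep}(0,t])$ is positive for all large $t$, the limit $$\mathcal{D}_\pi:=\lim_{t\to\infty}\frac{{\rm var}\big(N_{\rm dep}(0,t]\big)}{{\rm E}\big(N_{\rm dep}(0,t]\big)}$$ exists, and $$\mathcal{D}_\pi=1-2\,\frac{\pi_J}{1-\pi_J}\sum_{i=0}^J P_i\Big(1-\pi_J\frac{P_i}{\pi_i}\Big),\qquad \mathcal{D}_\pi\ge\frac{\frac12-\pi_J}{1-\pi_J}.$$ Moreover, let $\beta\in\mathbb{R}$ and $\eta>0$, and consider a sequence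 of $M/M/s/K$ queues with $s=s_n\ge1$ servers, $K=K_n$ waiting places, arrival rate $\lambda_n>0$ and service rate $\mu_n/s_n>0$ per server; that is, birth--death processes on $\{0,\dots,s_n+K_n\}$ with constant birth rate $\lambda_n$ and death rates $\min(i,s_n)\,\mu_n/s_n$, $1\le i\le s_n+K_n$. Suppose that, as $n\to\infty$, $s_n\to\infty$, $(1-\lambda_n/\mu_n)\sqrt{s_n}\to\beta$ and $K_n/\sqrt{s_n}\to\eta$. Then the stationary probability of the full state $s_n+K_n$ tends to $0$, and the asymptotic variance-to-mean ratios $\mathcal{D}^{(n)}$ of the numbers of departures (deaths) in these queues exist and satisfy $\liminf_{n\to\infty}\mathcal{D}^{(n)}\ge\frac12$. In particular, the limit $\mathcal{D}_{\beta,\eta}=\lim_{n\to\infty}\mathcal{D}^{(n)}$, whenever it exists, satisfies $\mathcal{D}_{\beta,\eta}\ge\frac12$. -/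

import Mathlib

open MeasureTheory ProbabilityTheory Filter Topology
open scoped NNReal

/-- Transition rates of the birth-death chain on `{0, …, J}`: `i → i + 1` at rate `birth i`
(for `i < J`) and `i → i - 1` at rate `death i` (for `1 ≤ i`). -/
def bdRate (J : ℕ) (birth death : ℕ → ℝ) : Matrix (Fin (J + 1)) (Fin (J + 1)) ℝ :=
  Matrix.of fun i j =>
    if (j : ℕ) = i + 1 then birth i else if (i : ℕ) = j + 1 then death i else 0

/-- The infinitesimal generator: the off-diagonal rates, with minus the total exit rate on the
diagonal, so that all rows sum to zero. -/
def bdGenerator (J : ℕ) (birth death : ℕ → ℝ) : Matrix (Fin (J + 1)) (Fin (J + 1)) ℝ :=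
  bdRate J birth death - Matrix.diagonal fun i => ∑ k, bdRate J birth death i k

/-- `π` is a probability vector on `{0, …, J}` with `π G = 0`. -/
structure IsStationaryDistribution {J : ℕ} (G : Matrix (Fin (J + 1)) (Fin (J + 1)) ℝ)
    (π : Fin (J + 1) → ℝ) : Prop where
  nonneg : ∀ i, 0 ≤ π i
  sum_eq_one : ∑ i, π i = 1
  balance : Matrix.vecMul π G = 0

/-- The cumulative distribution `P_i = ∑_{j ≤ i} π_j`. -/
def cumulative {J : ℕ} (π : Fin (J + 1) → ℝ) (i : Fin (J + 1)) : ℝ :=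
  ∑ j ∈ Finset.Iic i, π j

/-- `Q` is a continuous-time Markov chain on `{0, …, J}` with generator `G`, with an arbitrary
initial law: its paths are right-continuous with left limits (for the discrete topology of the
state space), and its finite-dimensional distributions are those of the Markov semigroup
`exp (t G)`. -/
structure IsMarkovChainWithGenerator {J : ℕ} (G : Matrix (Fin (J + 1)) (Fin (J + 1)) ℝ)
    {Ω : Type*} [MeasurableSpace Ω] (P : Measure Ω) (Q : ℝ≥0 → Ω → Fin (J + 1)) : Prop where
  measurable : ∀ t, Measurable (Q t)
  right_continuous : ∀ ω t, ∀ᶠ u in 𝓝[>] t, Q u ω = Q t ω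
  left_limit : ∀ ω t, 0 < t → ∃ i, ∀ᶠ u in 𝓝[<] t, Q u ω = i
  finite_dim : ∀ (n : ℕ) (t : ℕ → ℝ≥0), Monotone t → ∀ i : ℕ → Fin (J + 1),
    P.real {ω | ∀ k ≤ n, Q (t k) ω = i k} =
      P.real {ω | Q (t 0) ω = i 0} *
        ∏ k ∈ Finset.range n,
          NormedSpace.exp (((t (k + 1) : ℝ) - (t k : ℝ)) • G) (i k) (i (k + 1))

/-- A birth-death process on `{0, …, J}` with the given birth and death rates. -/
def IsBirthDeathProcess (J : ℕ) (birth death : ℕ → ℝ)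
    {Ω : Type*} [MeasurableSpace Ω] (P : Measure Ω) (Q : ℝ≥0 → Ω → Fin (J + 1)) : Prop :=
  IsMarkovChainWithGenerator (bdGenerator J birth death) P Q

/-- The number of deaths in `(0, t]`: the number of times `u ∈ (0, t]` at which the path jumps
downwards, that is, `Q(u) < Q(u-)`. -/
noncomputable def deathCount {J : ℕ} {Ω : Type*} (Q : ℝ≥0 → Ω → Fin (J + 1)) (t : ℝ≥0) (ω : Ω) : ℝ :=
  (Set.ncard {u : ℝ≥0 | 0 < u ∧ u ≤ t ∧ ∃ i, (∀ᶠ v in 𝓝[<] u, Q v ω = i) ∧ Q u ω < i} : ℝ)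

/-- The asymptotic variance-to-mean ratio of the number of deaths exists and equals `d`. -/
structure HasAsymptoticRatio {J : ℕ} {Ω : Type*} [MeasurableSpace Ω] (P : Measure Ω)
    (Q : ℝ≥0 → Ω → Fin (J + 1)) (d : ℝ) : Prop where
  square_integrable : ∀ t, MemLp (deathCount Q t) 2 P
  mean_pos : ∀ᶠ t in atTop, 0 < ∫ ω, deathCount Q t ω ∂P
  tendsto : Tendsto (fun t => variance (deathCount Q t) P / ∫ ω, deathCount Q t ω ∂P)
    atTop (𝓝 d)

/-- Death rates of the M/M/s/K queue in which each of the `s` servers works at rate `μ / s`. The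
queue length is the birth-death process on `{0, …, s + K}` with these death rates and with
constant birth rate. -/
noncomputable def mmskDeath (s : ℕ) (μ : ℝ) (i : ℕ) : ℝ := (min i s : ℕ) * (μ / s)

open scoped Matrix Matrix.Norms.Operator

/-! Write N for the number of deaths in (0,t], G for the generator, L for its strictly lower
triangular part (the downward rates), and m for the limit law.

Moments. The restrictions of E[C(N,r)], r = 0, 1, 2, to the events Q(t) = j form three row vectors.
Along a time grid, the Markov property and Pascal's rule give a linear recursion for them, whose
step is `momentStep` of the transition matrix. Refining dyadic grids turns its powers into exp(t ·
`momentStep G`) (`tendsto_pow_exp_of_hasDerivAt`). On càdlàg paths the dyadic counts increase to N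
and eventually equal it, so Fatou and dominated convergence identify this flow with the true
moments; the second moment is finite as a by-product.

Variance. If Gf = L1 − a, the compensated process N − f(Q) − at has constant mean. If moreover Gψ =
2af + L1 − 2Lf − γ, then Var N − 2 Cov(N, f(Q)) − (E f(Q))² − E ψ(Q) − γt is constant in t. State
functions are bounded and the covariance is O(√Var N), so Var N / t → γ and E N / t → a, for every
initial law and without any mixing estimate
(`IsMarkovChainWithGenerator.hasAsymptoticRatio_of_poisson`).

Birth-death chains. Detailed balance solves both Poisson equations explicitly. With constant birth
rate, a = λ(1 − π_J), and the increments of f are −(1 − π_J P_k/π_k); summation by parts turns γ/a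
into the stated formula. The lower bound is y(1 − y) ≤ 1/4 with y = π_J P_k/π_k, averaged over π.

Queues. Above level s the stationary weights are geometric with ratio the load, which is 1 +
O(1/√s). The K + 1 ~ η√s top states therefore have comparable weights, the full state has
probability O(1/K), and the lower bound tends to 1/2. -/

/-! ### Down jumps of a càdlàg path and descents along grids -/

/-- The number of indices `k < n` at which the sequence `x` decreases from `k` to `k + 1`. -/
def downCount {α : Type*} [LinearOrder α] (x : ℕ → α) (n : ℕ) : ℕ :=
  ∑ k ∈ Finset.range n, if x (k + 1) < x k then 1 else 0

theorem downCount_succ {α : Type*} [LinearOrder α] (x : ℕ → α) (n : ℕ) :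
    downCount x (n + 1) = downCount x n + if x (n + 1) < x n then 1 else 0 :=
  Finset.sum_range_succ _ _

theorem downCount_congr {α : Type*} [LinearOrder α] {x y : ℕ → α} {n : ℕ}
    (h : ∀ k ≤ n, x k = y k) : downCount x n = downCount y n := by
  refine Finset.sum_congr rfl fun k hk => ?_
  have hk := Finset.mem_range.1 hk
  rw [h k hk.le, h (k + 1) hk]

/-- A descent across two consecutive steps forces a descent in at least one of them, so refining a
grid loses no descents. -/
theorem downCount_subsequence_le {α : Type*} [LinearOrder α] (x : ℕ → α) (n : ℕ) :
    downCount (fun k => x (2 * k)) n ≤ downCount x (2 * n) := by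
  induction n with
  | zero => simp [downCount]
  | succ n ih =>
    rw [downCount_succ, show 2 * (n + 1) = 2 * n + 1 + 1 by ring, downCount_succ x, downCount_succ x,
      add_assoc (downCount x (2 * n))]
    refine add_le_add ih ?_
    by_cases h1 : x (2 * n + 1) < x (2 * n)
    · rw [if_pos h1]
      split_ifs <;> omega
    · by_cases h2 : x (2 * n + 1 + 1) < x (2 * n + 1)
      · rw [if_pos h2]
        split_ifs <;> omega
      · rw [if_neg (not_lt.2 ((not_lt.1 h1).trans (not_lt.1 h2)))]
        exact Nat.zero_le _

/-- The times in `(a, b]` at which the path `q` jumps downwards. -/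
def downJumps {α : Type*} [LinearOrder α] (q : ℝ≥0 → α) (a b : ℝ≥0) : Set ℝ≥0 :=
  {u | a < u ∧ u ≤ b ∧ ∃ i, (∀ᶠ v in 𝓝[<] u, q v = i) ∧ q u < i}

theorem downJumps_union {α : Type*} [LinearOrder α] (q : ℝ≥0 → α) {a b c : ℝ≥0}
    (hab : a ≤ b) (hbc : b ≤ c) : downJumps q a c = downJumps q a b ∪ downJumps q b c := by
  ext u
  simp only [downJumps, Set.mem_ofPred_eq, Set.mem_union]
  constructor
  · rintro ⟨h1, h2, h3⟩
    rcases le_or_gt u b with h | h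
    · exact Or.inl ⟨h1, h, h3⟩
    · exact Or.inr ⟨h, h2, h3⟩
  · rintro (⟨h1, h2, h3⟩ | ⟨h1, h2, h3⟩)
    · exact ⟨h1, h2.trans hbc, h3⟩
    · exact ⟨hab.trans_lt h1, h2, h3⟩

theorem downJumps_disjoint {α : Type*} [LinearOrder α] (q : ℝ≥0 → α) (a b c : ℝ≥0) :
    Disjoint (downJumps q a b) (downJumps q b c) :=
  Set.disjoint_left.2 fun _ h1 h2 => absurd h2.1 (not_lt.2 h1.2.1)

theorem NNReal.neBot_nhdsLT {u : ℝ≥0} (hu : 0 < u) : (𝓝[<] u).NeBot :=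
  mem_closure_iff_nhdsWithin_neBot.1 (by
    rw [closure_Iio' ⟨0, Set.mem_Iio.2 hu⟩]; exact Set.self_mem_Iic)

/-- A path with a single jump at `u` in `[a, b]` has a down jump in `(a, b]` exactly if it
decreases from `a` to `b`. -/
theorem downJumps_of_single_jump {α : Type*} [LinearOrder α] {q : ℝ≥0 → α} {a b u : ℝ≥0} {i : α}
    (hab : a ≤ b) (hlt : ∀ v ∈ Set.Icc a b, v < u → q v = i)
    (hge : ∀ v ∈ Set.Icc a b, u ≤ v → q v = q u) :
    downJumps q a b = if q b < q a then {u} else ∅ := by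
  have ha : a ∈ Set.Icc a b := ⟨le_rfl, hab⟩
  have hb : b ∈ Set.Icc a b := ⟨hab, le_rfl⟩
  have hleft : ∀ x, a < x → x ≤ b → x ≤ u → ∀ᶠ v in 𝓝[<] x, q v = i := by
    intro x hax hxb hxu
    filter_upwards [self_mem_nhdsWithin, mem_nhdsWithin_of_mem_nhds (lt_mem_nhds hax)] with v h1 h2
    exact hlt v ⟨le_of_lt h2, (le_of_lt h1).trans hxb⟩ (lt_of_lt_of_le h1 hxu)
  have hright : ∀ x, a < x → x ≤ b → u < x → ∀ᶠ v in 𝓝[<] x, q v = q u := by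
    intro x hax hxb hxu
    filter_upwards [self_mem_nhdsWithin, mem_nhdsWithin_of_mem_nhds (lt_mem_nhds hax),
      mem_nhdsWithin_of_mem_nhds (lt_mem_nhds hxu)] with v h1 h2 h3
    exact hge v ⟨le_of_lt h2, (le_of_lt h1).trans hxb⟩ (le_of_lt h3)
  have huniq : ∀ x, a < x → ∀ j k, (∀ᶠ v in 𝓝[<] x, q v = j) → (∀ᶠ v in 𝓝[<] x, q v = k) →
      j = k := by
    intro x hax j k h1 h2
    have := NNReal.neBot_nhdsLT (bot_le.trans_lt hax)
    obtain ⟨v, h3, h4⟩ := (h1.and h2).exists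
    exact h3.symm.trans h4
  have hsub : ∀ x ∈ downJumps q a b, x = u ∧ q u < i := by
    rintro x ⟨hax, hxb, j, hj, hlt'⟩
    rcases lt_trichotomy x u with h | h | h
    · rw [huniq x hax j i hj (hleft x hax hxb h.le), hlt x ⟨hax.le, hxb⟩ h] at hlt'
      exact absurd hlt' (lt_irrefl _)
    · subst h
      rw [huniq x hax j i hj (hleft x hax hxb le_rfl)] at hlt'
      exact ⟨rfl, hlt'⟩
    · rw [huniq x hax j _ hj (hright x hax hxb h), hge x ⟨hax.le, hxb⟩ h.le] at hlt'
      exact absurd hlt' (lt_irrefl _)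
  by_cases hu : a < u ∧ u ≤ b
  · rw [hlt a ha hu.1, hge b hb hu.2]
    split_ifs with h
    · exact Set.Subset.antisymm (fun x hx => (hsub x hx).1)
        (Set.singleton_subset_iff.2 ⟨hu.1, hu.2, i, hleft u hu.1 hu.2 le_rfl, h⟩)
    · exact Set.eq_empty_of_forall_notMem fun x hx => h (hsub x hx).2
  · have hq : q b = q a := by
      rcases le_or_gt u a with h | h
      · rw [hge a ha h, hge b hb (h.trans hab)]
      · have h' : b < u := by
          by_contra h2; exact hu ⟨h, not_lt.1 h2⟩
        rw [hlt a ha h, hlt b hb h']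
    rw [hq, if_neg (lt_irrefl _)]
    refine Set.eq_empty_of_forall_notMem fun x hx => hu ?_
    rw [← (hsub x hx).1]
    exact ⟨hx.1, hx.2.1⟩

/-- On a sufficiently fine grid, the number of down jumps of a càdlàg path is the number of grid
intervals over which it decreases. -/
theorem exists_forall_ncard_downJumps_eq {α : Type*} [LinearOrder α] {q : ℝ≥0 → α}
    (hrc : ∀ t, ∀ᶠ u in 𝓝[>] t, q u = q t)
    (hll : ∀ t, 0 < t → ∃ i, ∀ᶠ u in 𝓝[<] t, q u = i) (t : ℝ≥0) :
    ∃ ε : ℝ≥0, 0 < ε ∧ ∀ (h : ℝ≥0) (n : ℕ), h < ε → n * h ≤ t →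
      (downJumps q 0 (n * h)).Finite ∧
        (downJumps q 0 (n * h)).ncard = downCount (fun k => q (k * h)) n := by
  -- The one-sided limits at u give a ball on which the path is constant to the left of u and
  -- constant from u on, so it jumps at most at u.
  have hloc : ∀ u : ℝ≥0, ∃ δ : ℝ, 0 < δ ∧ ∃ i, (∀ v ∈ Metric.ball u δ, v < u → q v = i) ∧
      ∀ v ∈ Metric.ball u δ, u ≤ v → q v = q u := by
    intro u
    obtain ⟨i, hi⟩ : ∃ i, ∀ᶠ v in 𝓝[<] u, q v = i := by
      rcases eq_or_lt_of_le (zero_le (a := u)) with h | h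
      -- At u = 0 the left neighbourhood in `ℝ≥0` is empty, and any value serves.
      · refine ⟨q 0, ?_⟩
        filter_upwards [self_mem_nhdsWithin] with v hv
        rw [← h] at hv
        exact absurd (Set.mem_Iio.1 hv) (not_lt.2 zero_le)
      · exact hll u h
    have hr := hrc u
    rw [eventually_nhdsWithin_iff] at hi hr
    obtain ⟨δ, hδ, hball⟩ := Metric.eventually_nhds_iff_ball.1 (hi.and hr)
    refine ⟨δ, hδ, i, fun v hv hvu => (hball v hv).1 hvu, fun v hv huv => ?_⟩
    rcases eq_or_lt_of_le huv with h | h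
    · rw [h]
    · exact (hball v hv).2 h
  choose δ hδ i hlt hge using hloc
  -- With mesh below the Lebesgue number, each grid interval lies in one of these balls and so
  -- contains at most one jump.
  obtain ⟨ε, hε, hcov⟩ := lebesgue_number_lemma_of_metric (s := Set.Icc (0 : ℝ≥0) t)
    (c := fun u => Metric.ball u (δ u)) isCompact_Icc (fun _ => Metric.isOpen_ball)
    (fun u _ => Set.mem_iUnion.2 ⟨u, Metric.mem_ball_self (hδ u)⟩)
  refine ⟨⟨ε, hε.le⟩, hε, fun h n hhε => ?_⟩
  induction n with
  | zero =>
    intro _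
    have : downJumps q 0 ((0 : ℕ) * h) = ∅ := by
      refine Set.eq_empty_of_forall_notMem fun x hx => ?_
      have h1 := hx.1; have h2 := hx.2.1
      simp only [Nat.cast_zero, zero_mul] at h2
      exact absurd h1 (not_lt.2 h2)
    rw [this]
    simp [downCount]
  | succ n ih =>
    intro hn
    have hle : (n : ℝ≥0) * h ≤ ((n + 1 : ℕ) : ℝ≥0) * h := by gcongr; simp
    obtain ⟨hfin, hcard⟩ := ih (hle.trans hn)
    obtain ⟨u, hu⟩ := hcov (n * h) ⟨zero_le, hle.trans hn⟩
    have hmem : ∀ v ∈ Set.Icc ((n : ℝ≥0) * h) ((n + 1 : ℕ) * h), v ∈ Metric.ball u (δ u) := by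
      intro v hv
      refine hu ?_
      have h1 : ((n : ℝ≥0) * h : ℝ) ≤ v := by exact_mod_cast hv.1
      have h2 : (v : ℝ) ≤ (n + 1) * h := by exact_mod_cast hv.2
      have h3 : (h : ℝ) < ε := by exact_mod_cast hhε
      rw [Metric.mem_ball, NNReal.dist_eq, abs_lt]
      push_cast at h1 ⊢
      constructor <;> nlinarith
    have hsing := downJumps_of_single_jump (q := q) (u := u) (i := i u) hle
      (fun v hv => hlt u v (hmem v hv)) (fun v hv => hge u v (hmem v hv))
    have hfin' : (downJumps q (n * h) ((n + 1 : ℕ) * h)).Finite := by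
      rw [hsing]; split_ifs <;> simp
    rw [downJumps_union q (zero_le) hle]
    -- Finiteness travels with the count because `ncard` is 0 on infinite sets and additive only on
    -- finite ones.
    refine ⟨hfin.union hfin', ?_⟩
    rw [Set.ncard_union_eq (downJumps_disjoint q _ _ _) hfin hfin', hcard, downCount_succ, hsing]
    split_ifs <;> simp

theorem monotone_downCount_dyadic {α : Type*} [LinearOrder α] (q : ℝ≥0 → α) (t : ℝ≥0) :
    Monotone fun m : ℕ => downCount (fun k => q (k * (t / 2 ^ m))) (2 ^ m) := by
  refine monotone_nat_of_le_succ fun m => ?_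
  have := downCount_subsequence_le (fun k : ℕ => q (k * (t / 2 ^ (m + 1)))) (2 ^ m)
  rw [← pow_succ'] at this
  refine le_trans (le_of_eq ?_) this
  refine downCount_congr fun k _ => ?_
  congr 1
  push_cast
  rw [pow_succ]
  field_simp

theorem eventually_downCount_dyadic_eq {α : Type*} [LinearOrder α] {q : ℝ≥0 → α}
    (hrc : ∀ t, ∀ᶠ u in 𝓝[>] t, q u = q t)
    (hll : ∀ t, 0 < t → ∃ i, ∀ᶠ u in 𝓝[<] t, q u = i) (t : ℝ≥0) :
    ∀ᶠ m : ℕ in atTop,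
      downCount (fun k => q (k * (t / 2 ^ m))) (2 ^ m) = (downJumps q 0 t).ncard := by
  obtain ⟨ε, hε, hcard⟩ := exists_forall_ncard_downJumps_eq hrc hll t
  have hlim : Tendsto (fun m : ℕ => t / 2 ^ m) atTop (𝓝 0) := by
    have := (tendsto_pow_atTop_nhds_zero_of_lt_one (r := (2⁻¹ : ℝ≥0)) (by simp)
      (by rw [← NNReal.coe_lt_coe]; norm_num)).const_mul t
    simpa [div_eq_mul_inv] using this
  filter_upwards [hlim.eventually (gt_mem_nhds hε)] with m hm
  have heq : ((2 ^ m : ℕ) : ℝ≥0) * (t / 2 ^ m) = t := by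
    push_cast; field_simp
  have := (hcard (t / 2 ^ m) (2 ^ m) hm heq.le).2
  rw [heq] at this
  exact this.symm

/-- The dyadic counts increase with the level and eventually equal the number of jumps. This bound
supplies the domination when limits are taken under the integral. -/
theorem downCount_dyadic_le {α : Type*} [LinearOrder α] {q : ℝ≥0 → α}
    (hrc : ∀ t, ∀ᶠ u in 𝓝[>] t, q u = q t)
    (hll : ∀ t, 0 < t → ∃ i, ∀ᶠ u in 𝓝[<] t, q u = i) (t : ℝ≥0) (m : ℕ) :
    downCount (fun k => q (k * (t / 2 ^ m))) (2 ^ m) ≤ (downJumps q 0 t).ncard := by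
  obtain ⟨m', h1, h2⟩ :=
    ((eventually_downCount_dyadic_eq hrc hll t).and (eventually_ge_atTop m)).exists
  rw [← h1]
  exact monotone_downCount_dyadic q t h2

/-! ### The Markov property along a grid -/

section Markov

variable {J : ℕ} {G : Matrix (Fin (J + 1)) (Fin (J + 1)) ℝ} {Ω : Type*} [MeasurableSpace Ω]
  {P : Measure Ω} {Q : ℝ≥0 → Ω → Fin (J + 1)}

theorem IsMarkovChainWithGenerator.measurableSet_cylinder
    (hQ : IsMarkovChainWithGenerator G P Q) (t : ℕ → ℝ≥0) (n : ℕ) (i : ℕ → Fin (J + 1)) :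
    MeasurableSet {ω | ∀ k ≤ n, Q (t k) ω = i k} := by
  have : {ω | ∀ k ≤ n, Q (t k) ω = i k} = ⋂ k, ⋂ (_ : k ≤ n), Q (t k) ⁻¹' {i k} := by
    ext ω; simp
  rw [this]
  exact MeasurableSet.iInter fun k => MeasurableSet.iInter fun _ =>
    hQ.measurable _ (measurableSet_singleton _)

/-- The Markov property at the times of a grid, for cylinder events. -/
theorem IsMarkovChainWithGenerator.measureReal_cylinder_succ
    (hQ : IsMarkovChainWithGenerator G P Q) {t : ℕ → ℝ≥0} (ht : Monotone t) (n : ℕ)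
    (i : ℕ → Fin (J + 1)) (j : Fin (J + 1)) :
    P.real ({ω | ∀ k ≤ n, Q (t k) ω = i k} ∩ {ω | Q (t (n + 1)) ω = j}) =
      P.real {ω | ∀ k ≤ n, Q (t k) ω = i k} *
        NormedSpace.exp (((t (n + 1) : ℝ) - (t n : ℝ)) • G) (i n) j := by
  set i' : ℕ → Fin (J + 1) := fun k => if k ≤ n then i k else j with hi'
  have hset : {ω | ∀ k ≤ n, Q (t k) ω = i k} ∩ {ω | Q (t (n + 1)) ω = j} =
      {ω | ∀ k ≤ n + 1, Q (t k) ω = i' k} := by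
    ext ω
    simp only [Set.mem_inter_iff, Set.mem_ofPred_eq, hi']
    constructor
    · rintro ⟨h1, h2⟩ k hk
      rcases Nat.le_succ_iff.1 hk with h | h
      · rw [if_pos h, h1 k h]
      · subst h; simpa using h2
    · intro h
      refine ⟨fun k hk => ?_, ?_⟩
      · simpa [hk] using h k (hk.trans n.le_succ)
      · simpa using h (n + 1) le_rfl
  rw [hset, hQ.finite_dim (n + 1) t ht i', hQ.finite_dim n t ht i, Finset.prod_range_succ,
    ← mul_assoc]
  congr 1
  · congr 1
    refine Finset.prod_congr rfl fun k hk => ?_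
    have hk := Finset.mem_range.1 hk
    simp [hi', hk.le, Nat.succ_le_of_lt hk]
  · simp [hi']

/-- The Markov property at the times of a grid, for functions of the past of the path. -/
theorem IsMarkovChainWithGenerator.integral_mul_ite_succ [IsProbabilityMeasure P]
    (hQ : IsMarkovChainWithGenerator G P Q) {t : ℕ → ℝ≥0} (ht : Monotone t) (n : ℕ)
    {F : (ℕ → Fin (J + 1)) → ℝ} (hF : ∀ x y, (∀ k ≤ n, x k = y k) → F x = F y)
    (j : Fin (J + 1)) :
    ∫ ω, F (fun k => Q (t k) ω) * (if Q (t (n + 1)) ω = j then 1 else 0) ∂P =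
      ∑ i, (∫ ω, F (fun k => Q (t k) ω) * (if Q (t n) ω = i then 1 else 0) ∂P) *
        NormedSpace.exp (((t (n + 1) : ℝ) - (t n : ℝ)) • G) i j := by
  classical
  -- The past up to step n takes finitely many values v. Freezing v after its last coordinate makes
  -- it an argument of F, which by `hF` sees only the first n + 1 entries, so each expectation is a
  -- finite sum over cylinders.
  set ext : (Fin (n + 1) → Fin (J + 1)) → ℕ → Fin (J + 1) :=
    fun v k => v ⟨min k n, by omega⟩ with hext
  set A : (Fin (n + 1) → Fin (J + 1)) → Set Ω := fun v => {ω | ∀ k ≤ n, Q (t k) ω = ext v k}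
    with hA
  have hAmeas : ∀ v, MeasurableSet (A v) := fun v => hQ.measurableSet_cylinder t n _
  have hAmem : ∀ ω v, ω ∈ A v ↔ v = fun k : Fin (n + 1) => Q (t k) ω := by
    intro ω v
    simp only [hA, hext, Set.mem_ofPred_eq]
    constructor
    · intro h
      funext k
      have hk : (k : ℕ) ≤ n := Nat.lt_succ_iff.1 k.2
      rw [h k hk]
      congr 1
      exact Fin.ext (by simp [hk])
    · rintro rfl k hk
      simp [hk]
  have hdecomp : ∀ (g : Ω → ℝ) ω, F (fun k => Q (t k) ω) * g ω =
      ∑ v, F (ext v) * ((A v).indicator g ω) := by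
    intro g ω
    rw [Finset.sum_eq_single (fun k : Fin (n + 1) => Q (t k) ω)]
    · rw [Set.indicator_of_mem ((hAmem ω _).2 rfl)]
      congr 1
      exact hF _ _ fun k hk => by simp [hext, hk]
    · intro v _ hv
      rw [Set.indicator_of_notMem fun h => hv ((hAmem ω v).1 h), mul_zero]
    · simp
  have hstate : ∀ s i, MeasurableSet {ω | Q s ω = i} := fun s i =>
    hQ.measurable s (measurableSet_singleton i)
  have hint : ∀ s i, ∫ ω, F (fun k => Q (t k) ω) * (if Q s ω = i then 1 else 0) ∂P =
      ∑ v, F (ext v) * P.real (A v ∩ {ω | Q s ω = i}) := by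
    intro s i
    have h1 : ∀ v, (A v).indicator (fun ω => if Q s ω = i then (1 : ℝ) else 0) =
        (A v ∩ {ω | Q s ω = i}).indicator 1 := by
      intro v
      funext ω
      by_cases h : ω ∈ A v <;> by_cases h' : Q s ω = i <;> simp [h, h']
    simp_rw [hdecomp (fun ω => if Q s ω = i then 1 else 0), h1]
    rw [integral_finsetSum]
    · refine Finset.sum_congr rfl fun v _ => ?_
      rw [integral_const_mul, integral_indicator_one ((hAmeas v).inter (hstate s i))]
    · intro v _
      refine Integrable.const_mul ?_ _
      exact (integrable_const (1 : ℝ)).indicator ((hAmeas v).inter (hstate s i))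
  simp_rw [hint, Finset.sum_mul]
  rw [Finset.sum_comm]
  refine Finset.sum_congr rfl fun v _ => ?_
  rw [hQ.measureReal_cylinder_succ ht]
  have hin : ∀ i, A v ∩ {ω | Q (t n) ω = i} = if ext v n = i then A v else ∅ := by
    intro i
    split_ifs with h
    · refine Set.inter_eq_left.2 fun ω hω => ?_
      exact (hω n le_rfl).trans h
    · refine Set.eq_empty_of_forall_notMem fun ω hω => h ?_
      exact (hω.1 n le_rfl).symm.trans hω.2
  simp_rw [hin]
  rw [Finset.sum_eq_single (ext v n)]
  · rw [if_pos rfl]; ring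
  · intro i _ hi
    rw [if_neg hi.symm]; simp
  · simp

end Markov

/-! ### A product formula for the exponential -/

/-- Telescoping: X^(n+1) − Y^(n+1) = X(X^n − Y^n) + (X − Y)Y^n. -/
theorem norm_pow_sub_pow_le_of_norm_le {A : Type*} [NormedRing A] [NormOneClass A] {X Y : A} {M : ℝ}
    (hM : 1 ≤ M) (hX : ‖X‖ ≤ M) (hY : ‖Y‖ ≤ M) (n : ℕ) :
    ‖X ^ n - Y ^ n‖ ≤ n * M ^ n * ‖X - Y‖ := by
  induction n with
  | zero => simp
  | succ n ih =>
    have h0 : 0 ≤ M := zero_le_one.trans hM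
    have heq : X ^ (n + 1) - Y ^ (n + 1) = X * (X ^ n - Y ^ n) + (X - Y) * Y ^ n := by
      rw [pow_succ', pow_succ']; noncomm_ring
    have h1 : ‖Y ^ n‖ ≤ M ^ (n + 1) :=
      (norm_pow_le Y n).trans ((pow_le_pow_left₀ (norm_nonneg _) hY n).trans
        (pow_le_pow_right₀ hM n.le_succ))
    calc ‖X ^ (n + 1) - Y ^ (n + 1)‖ ≤ ‖X‖ * ‖X ^ n - Y ^ n‖ + ‖X - Y‖ * ‖Y ^ n‖ := by
          rw [heq]
          exact (norm_add_le _ _).trans (add_le_add (norm_mul_le _ _) (norm_mul_le _ _))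
      _ ≤ M * (n * M ^ n * ‖X - Y‖) + ‖X - Y‖ * M ^ (n + 1) := by gcongr
      _ = (n + 1 : ℕ) * M ^ (n + 1) * ‖X - Y‖ := by push_cast; ring

/-- Powers of a curve through `1` with derivative `L` converge to the exponential of `L`. -/
theorem tendsto_pow_exp_of_hasDerivAt {A : Type*} [NormedRing A] [NormOneClass A]
    [NormedAlgebra ℝ A] [CompleteSpace A] {B : ℝ → A} {L : A} (hB0 : B 0 = 1)
    (hB : HasDerivAt B L 0) {t : ℝ} (ht : 0 ≤ t) {N : ℕ → ℕ} (hN : Tendsto N atTop atTop) :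
    Tendsto (fun m => B (t / N m) ^ N m) atTop (𝓝 (NormedSpace.exp (t • L))) := by
  rcases eq_or_lt_of_le ht with rfl | ht
  · simp [hB0]
  have hE : HasDerivAt (fun h : ℝ => NormedSpace.exp (h • L)) L 0 := by
    simpa using hasDerivAt_exp_smul_const (𝕂 := ℝ) L 0
  have hE0 : NormedSpace.exp ((0 : ℝ) • L) = 1 := by simp
  -- First-order expansion bounds each factor by exp((‖L‖ + 1)h), so a product of N factors with h =
  -- t/N stays below exp((‖L‖ + 1)t).
  have hsmall : ∀ {C : ℝ → A}, C 0 = 1 → HasDerivAt C L 0 →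
      ∀ᶠ h in 𝓝[>] (0 : ℝ), ‖C h‖ ≤ Real.exp ((‖L‖ + 1) * h) := by
    intro C hC0 hC
    have := (hC.isLittleO).def (c := 1) one_pos
    filter_upwards [mem_nhdsWithin_of_mem_nhds this, self_mem_nhdsWithin] with h hh hpos
    have hpos : 0 < h := hpos
    simp only [sub_zero, hC0, Real.norm_eq_abs, abs_of_pos hpos, one_mul] at hh
    calc ‖C h‖ = ‖(C h - 1 - h • L) + 1 + h • L‖ := by congr 1; abel
      _ ≤ ‖C h - 1 - h • L‖ + ‖(1 : A)‖ + ‖h • L‖ := norm_add₃_le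
      _ ≤ h + 1 + h * ‖L‖ := by
        rw [norm_one, norm_smul, Real.norm_eq_abs, abs_of_pos hpos]; gcongr
      _ = (‖L‖ + 1) * h + 1 := by ring
      _ ≤ _ := Real.add_one_le_exp _
  have hstep : Tendsto (fun m => t / (N m : ℝ)) atTop (𝓝[>] 0) := by
    refine tendsto_nhdsWithin_iff.2 ⟨?_, ?_⟩
    · exact (tendsto_const_div_atTop_nhds_zero_nat t).comp hN
    · filter_upwards [hN.eventually (eventually_gt_atTop 0)] with m hm
      exact div_pos ht (Nat.cast_pos.2 hm)
  -- The two curves are tangent at 0, so their difference is o(h); this beats the factor N = t/h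
  -- from the telescoping.
  have hdiff : Tendsto (fun h : ℝ => ‖B h - NormedSpace.exp (h • L)‖ / h) (𝓝[>] 0) (𝓝 0) := by
    have h1 : HasDerivAt (fun h => B h - NormedSpace.exp (h • L)) 0 0 := by
      have := hB.sub hE
      rw [sub_self] at this
      exact this
    have h2 := (hasDerivAt_iff_tendsto.1 h1).mono_left
      (nhdsWithin_le_nhds (s := Set.Ioi (0 : ℝ)))
    refine h2.congr' ?_
    filter_upwards [self_mem_nhdsWithin] with h hpos
    have hpos : 0 < h := hpos
    simp [hB0, abs_of_pos hpos, div_eq_inv_mul]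
  have hlim : Tendsto (fun m => t * Real.exp ((‖L‖ + 1) * t) *
      (‖B (t / N m) - NormedSpace.exp ((t / (N m : ℝ)) • L)‖ / (t / N m))) atTop (𝓝 0) := by
    simpa using (hdiff.comp hstep).const_mul (t * Real.exp ((‖L‖ + 1) * t))
  rw [tendsto_iff_norm_sub_tendsto_zero]
  refine squeeze_zero' (Eventually.of_forall fun _ => norm_nonneg _) ?_ hlim
  filter_upwards [hstep.eventually (hsmall hB0 hB), hstep.eventually (hsmall hE0 hE),
    hN.eventually (eventually_gt_atTop 0)] with m h1 h2 h3
  have hNpos : (0 : ℝ) < N m := Nat.cast_pos.2 h3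
  have hpow : NormedSpace.exp (t • L) = NormedSpace.exp ((t / (N m : ℝ)) • L) ^ N m := by
    let _ := NormedAlgebra.restrictScalars ℚ ℝ A
    rw [← NormedSpace.exp_nsmul, ← Nat.cast_smul_eq_nsmul ℝ, smul_smul]
    congr 2
    field_simp
  have hM : 1 ≤ Real.exp ((‖L‖ + 1) * (t / N m)) := Real.one_le_exp (by positivity)
  have := norm_pow_sub_pow_le_of_norm_le hM h1 h2 (N m)
  rw [hpow]
  refine this.trans (le_of_eq ?_)
  rw [← Real.exp_nat_mul]
  have : (N m : ℝ) * ((‖L‖ + 1) * (t / N m)) = (‖L‖ + 1) * t := by field_simp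
  rw [this]
  field_simp

/-! ### The linear evolution of binomial moments -/

/-- The strictly lower triangular part of a matrix: the downward transitions. -/
def lowerPart {J : ℕ} (X : Matrix (Fin (J + 1)) (Fin (J + 1)) ℝ) :
    Matrix (Fin (J + 1)) (Fin (J + 1)) ℝ :=
  Matrix.of fun i j => if j < i then X i j else 0

theorem lowerPart_add {J : ℕ} (X Y : Matrix (Fin (J + 1)) (Fin (J + 1)) ℝ) :
    lowerPart (X + Y) = lowerPart X + lowerPart Y := by
  ext i j
  simp only [lowerPart, Matrix.of_apply, Matrix.add_apply]
  split_ifs <;> simp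

theorem lowerPart_smul {J : ℕ} (c : ℝ) (X : Matrix (Fin (J + 1)) (Fin (J + 1)) ℝ) :
    lowerPart (c • X) = c • lowerPart X := by
  ext i j
  simp only [lowerPart, Matrix.of_apply, Matrix.smul_apply]
  split_ifs <;> simp

theorem lowerPart_one {J : ℕ} :
    lowerPart (1 : Matrix (Fin (J + 1)) (Fin (J + 1)) ℝ) = 0 := by
  ext i j
  simp only [lowerPart, Matrix.of_apply, Matrix.zero_apply]
  split_ifs with h
  · exact Matrix.one_apply_ne h.ne'
  · rfl

/-- Triples of row vectors, which hold the binomial moments of orders `0`, `1`, `2` of the number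
of down jumps on the events that the chain is in a given state. -/
abbrev MomentSpace (J : ℕ) : Type :=
  (Fin (J + 1) → ℝ) × (Fin (J + 1) → ℝ) × (Fin (J + 1) → ℝ)

/-- The action of a transition matrix on the binomial moments. -/
noncomputable def momentStep {J : ℕ} :
    Matrix (Fin (J + 1)) (Fin (J + 1)) ℝ →ₗ[ℝ] (MomentSpace J →L[ℝ] MomentSpace J) where
  toFun X := LinearMap.toContinuousLinearMap
    { toFun := fun v => (v.1 ᵥ* X, v.2.1 ᵥ* X + v.1 ᵥ* lowerPart X,
        v.2.2 ᵥ* X + v.2.1 ᵥ* lowerPart X)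
      map_add' := fun v w => by
        simp only [Prod.fst_add, Prod.snd_add, Matrix.add_vecMul, Prod.mk_add_mk]
        congr 2 <;> abel
      map_smul' := fun c v => by
        simp [Matrix.smul_vecMul] }
  map_add' X Y := by
    refine ContinuousLinearMap.ext fun v => ?_
    simp only [LinearMap.coe_toContinuousLinearMap', LinearMap.coe_mk, AddHom.coe_mk,
      add_apply, lowerPart_add, Matrix.vecMul_add, Prod.mk_add_mk]
    congr 2 <;> abel
  map_smul' c X := by
    refine ContinuousLinearMap.ext fun v => ?_
    simp [lowerPart_smul, Matrix.vecMul_smul]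

theorem momentStep_apply {J : ℕ} (X : Matrix (Fin (J + 1)) (Fin (J + 1)) ℝ) (v : MomentSpace J) :
    momentStep X v = (v.1 ᵥ* X, v.2.1 ᵥ* X + v.1 ᵥ* lowerPart X,
      v.2.2 ᵥ* X + v.2.1 ᵥ* lowerPart X) := rfl

theorem momentStep_one {J : ℕ} :
    momentStep (1 : Matrix (Fin (J + 1)) (Fin (J + 1)) ℝ) = 1 := by
  refine ContinuousLinearMap.ext fun v => ?_
  rw [momentStep_apply]
  simp [lowerPart_one]

/-- `momentStep` is linear but not multiplicative, since a descent over two steps is not the sum of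
the descents in each. The powers are therefore exponentials only in the limit of fine grids;
linearity gives the derivative `momentStep G` at 0. -/
theorem tendsto_momentStep_exp_pow {J : ℕ} (G : Matrix (Fin (J + 1)) (Fin (J + 1)) ℝ) {t : ℝ}
    (ht : 0 ≤ t) {N : ℕ → ℕ} (hN : Tendsto N atTop atTop) :
    Tendsto (fun m => momentStep (NormedSpace.exp ((t / (N m : ℝ)) • G)) ^ N m) atTop
      (𝓝 (NormedSpace.exp (t • momentStep G))) := by
  refine tendsto_pow_exp_of_hasDerivAt (B := fun h => momentStep (NormedSpace.exp (h • G)))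
    (by simp [momentStep_one]) ?_ ht hN
  have h1 : HasDerivAt (fun h : ℝ => NormedSpace.exp (h • G)) G 0 := by
    have h := hasDerivAt_exp_smul_const (𝕂 := ℝ) G 0
    rw [zero_smul, NormedSpace.exp_zero, one_mul] at h
    exact h
  exact (LinearMap.toContinuousLinearMap (momentStep (J := J))).hasFDerivAt.comp_hasDerivAt 0 h1

/-! ### Binomial moments of the descents along a grid -/

section Moments

variable {J : ℕ} {G : Matrix (Fin (J + 1)) (Fin (J + 1)) ℝ} {Ω : Type*} [MeasurableSpace Ω]
  {P : Measure Ω} {Q : ℝ≥0 → Ω → Fin (J + 1)}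

theorem IsMarkovChainWithGenerator.measurable_downCount
    (hQ : IsMarkovChainWithGenerator G P Q) (t : ℕ → ℝ≥0) (n : ℕ) :
    Measurable fun ω => downCount (fun k => Q (t k) ω) n := by
  refine Finset.measurable_sum _ fun k _ => Measurable.ite ?_ measurable_const measurable_const
  exact ((hQ.measurable (t (k + 1))).prodMk (hQ.measurable (t k)))
    (MeasurableSet.of_discrete (s := {p : Fin (J + 1) × Fin (J + 1) | p.1 < p.2}))

theorem downCount_le {α : Type*} [LinearOrder α] (x : ℕ → α) (n : ℕ) : downCount x n ≤ n := by
  calc downCount x n ≤ ∑ _k ∈ Finset.range n, 1 :=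
        Finset.sum_le_sum fun k _ => by split_ifs <;> simp
    _ = n := by simp

/-- The binomial moments of the number of down steps along a grid, on the events that the chain is
in a given state at the end. -/
noncomputable def gridMoment (P : Measure Ω) (Q : ℝ≥0 → Ω → Fin (J + 1)) (t : ℕ → ℝ≥0)
    (r n : ℕ) (j : Fin (J + 1)) : ℝ :=
  ∫ ω, ((downCount (fun k => Q (t k) ω) n).choose r : ℝ) * (if Q (t n) ω = j then 1 else 0) ∂P

theorem IsMarkovChainWithGenerator.integrable_choose_downCount [IsProbabilityMeasure P]
    (hQ : IsMarkovChainWithGenerator G P Q) (t : ℕ → ℝ≥0) (r n : ℕ) (g : Ω → ℝ)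
    (hg : Measurable g) (hg1 : ∀ ω, |g ω| ≤ 1) :
    Integrable (fun ω => ((downCount (fun k => Q (t k) ω) n).choose r : ℝ) * g ω) P := by
  have hm : Measurable fun ω => ((downCount (fun k => Q (t k) ω) n).choose r : ℝ) :=
    (measurable_of_countable (fun m : ℕ => (m.choose r : ℝ))).comp (hQ.measurable_downCount t n)
  refine Integrable.of_bound (hm.mul hg).aestronglyMeasurable ((2 : ℝ) ^ n)
    (Eventually.of_forall fun ω => ?_)
  rw [norm_mul, Real.norm_eq_abs, Real.norm_eq_abs, Nat.abs_cast]
  have h1 : ((downCount (fun k => Q (t k) ω) n).choose r : ℝ) ≤ 2 ^ n := by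
    exact_mod_cast (Nat.choose_le_two_pow _ _).trans
      (Nat.pow_le_pow_right two_pos (downCount_le _ n))
  calc _ ≤ (2 : ℝ) ^ n * 1 := by gcongr; exact hg1 ω
    _ = 2 ^ n := mul_one _

theorem IsMarkovChainWithGenerator.measurable_ite (hQ : IsMarkovChainWithGenerator G P Q)
    (s : ℝ≥0) (p : Fin (J + 1) → Prop) [DecidablePred p] :
    Measurable fun ω => if p (Q s ω) then (1 : ℝ) else 0 :=
  (measurable_of_countable (fun i => if p i then (1 : ℝ) else 0)).comp (hQ.measurable s)

theorem IsMarkovChainWithGenerator.gridMoment_zero_succ [IsProbabilityMeasure P]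
    (hQ : IsMarkovChainWithGenerator G P Q) {t : ℕ → ℝ≥0} (ht : Monotone t) (n : ℕ) :
    gridMoment P Q t 0 (n + 1) = gridMoment P Q t 0 n ᵥ*
      NormedSpace.exp (((t (n + 1) : ℝ) - (t n : ℝ)) • G) := by
  funext j
  simpa [gridMoment, Matrix.vecMul, dotProduct] using
    hQ.integral_mul_ite_succ ht n (F := fun _ => 1) (fun _ _ _ => rfl) j

/-- Pascal's rule: a descent in the last step replaces C(N, r+1) by C(N, r+1) + C(N, r), and the
extra term only sees transitions to lower states. This is why binomial moments are used instead of
powers. -/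
theorem IsMarkovChainWithGenerator.gridMoment_succ_succ [IsProbabilityMeasure P]
    (hQ : IsMarkovChainWithGenerator G P Q) {t : ℕ → ℝ≥0} (ht : Monotone t) (r n : ℕ) :
    gridMoment P Q t (r + 1) (n + 1) = gridMoment P Q t (r + 1) n ᵥ*
        NormedSpace.exp (((t (n + 1) : ℝ) - (t n : ℝ)) • G) + gridMoment P Q t r n ᵥ*
        lowerPart (NormedSpace.exp (((t (n + 1) : ℝ) - (t n : ℝ)) • G)) := by
  funext j
  have hsplit : ∀ ω, ((downCount (fun k => Q (t k) ω) (n + 1)).choose (r + 1) : ℝ) *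
      (if Q (t (n + 1)) ω = j then 1 else 0) =
      ((downCount (fun k => Q (t k) ω) n).choose (r + 1) : ℝ) *
        (if Q (t (n + 1)) ω = j then 1 else 0) +
      (((downCount (fun k => Q (t k) ω) n).choose r : ℝ) * (if j < Q (t n) ω then 1 else 0)) *
        (if Q (t (n + 1)) ω = j then 1 else 0) := by
    intro ω
    rw [downCount_succ]
    by_cases h : Q (t (n + 1)) ω = j
    · simp only [h, if_true, mul_one]
      split_ifs
      · rw [Nat.choose_succ_succ]; push_cast; ring
      · simp
    · simp [h]
  have hm : ∀ s (p : Fin (J + 1) → Prop) [DecidablePred p] (ω : Ω),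
      |if p (Q s ω) then (1 : ℝ) else 0| ≤ 1 := by
    intro s p _ ω; split_ifs <;> simp
  have h1 := hQ.integral_mul_ite_succ ht n
    (F := fun x => ((downCount x n).choose (r + 1) : ℝ))
    (fun x y h => by rw [downCount_congr h]) j
  have h2 := hQ.integral_mul_ite_succ ht n
    (F := fun x => ((downCount x n).choose r : ℝ) * (if j < x n then 1 else 0))
    (fun x y h => by rw [downCount_congr h, h n le_rfl]) j
  have hi : ∀ i, ∫ ω, ((downCount (fun k => Q (t k) ω) n).choose r : ℝ) *
      (if j < Q (t n) ω then 1 else 0) * (if Q (t n) ω = i then 1 else 0) ∂P =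
      if j < i then gridMoment P Q t r n i else 0 := by
    intro i
    split_ifs with hji
    · refine integral_congr_ae (Eventually.of_forall fun ω => ?_)
      by_cases h : Q (t n) ω = i <;> simp [h, hji]
    · rw [← integral_zero Ω ℝ]
      refine integral_congr_ae (Eventually.of_forall fun ω => ?_)
      by_cases h : Q (t n) ω = i <;> simp [h, hji]
  simp_rw [hi] at h2
  rw [gridMoment, integral_congr_ae (Eventually.of_forall hsplit), integral_add, h1, h2]
  · simp only [Matrix.vecMul, dotProduct, Pi.add_apply, lowerPart, Matrix.of_apply]
    congr 1
    refine Finset.sum_congr rfl fun i _ => ?_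
    split_ifs <;> simp
  · exact hQ.integrable_choose_downCount t _ n _ (hQ.measurable_ite _ (· = j)) (hm _ (· = j))
  · simp_rw [mul_assoc]
    refine hQ.integrable_choose_downCount t _ n _
      ((hQ.measurable_ite _ (j < ·)).mul (hQ.measurable_ite _ (· = j))) fun ω => ?_
    rw [abs_mul]
    exact mul_le_one₀ (hm _ (j < ·) ω) (abs_nonneg _) (hm _ (· = j) ω)

/-- The vector of the initial distribution, with no down jumps. -/
noncomputable def initialMoments (P : Measure Ω) (Q : ℝ≥0 → Ω → Fin (J + 1)) : MomentSpace J :=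
  (fun j => ∫ ω, (if Q 0 ω = j then 1 else 0) ∂P, 0, 0)

theorem IsMarkovChainWithGenerator.gridMoment_eq_pow [IsProbabilityMeasure P]
    (hQ : IsMarkovChainWithGenerator G P Q) (h : ℝ≥0) (n : ℕ) :
    (gridMoment P Q (fun k => k * h) 0 n, gridMoment P Q (fun k => k * h) 1 n,
      gridMoment P Q (fun k => k * h) 2 n) =
      (momentStep (NormedSpace.exp ((h : ℝ) • G)) ^ n) (initialMoments P Q) := by
  have ht : Monotone fun k : ℕ => (k : ℝ≥0) * h := fun a b hab => by
    dsimp only; gcongr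
  induction n with
  | zero =>
    have h1 : gridMoment P Q (fun k => k * h) 1 0 = 0 := by
      funext j; simp [gridMoment, downCount]
    have h2 : gridMoment P Q (fun k => k * h) 2 0 = 0 := by
      funext j; simp [gridMoment, downCount]
    rw [h1, h2, pow_zero, initialMoments]
    congr 1
    funext j
    simp [gridMoment]
  | succ n ih =>
    rw [pow_succ', mul_apply_eq_comp, ← ih, momentStep_apply,
      hQ.gridMoment_zero_succ ht, hQ.gridMoment_succ_succ ht, hQ.gridMoment_succ_succ ht]
    have hstep : (((n + 1 : ℕ) : ℝ≥0) * h : ℝ≥0) - ((n : ℝ≥0) * h : ℝ≥0) = (h : ℝ) := by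
      push_cast; ring
    simp only [hstep]

/-- The flow of the binomial moments. -/
noncomputable def momentFlow (G : Matrix (Fin (J + 1)) (Fin (J + 1)) ℝ) (P : Measure Ω)
    (Q : ℝ≥0 → Ω → Fin (J + 1)) (t : ℝ) : MomentSpace J :=
  NormedSpace.exp (t • momentStep G) (initialMoments P Q)

theorem IsMarkovChainWithGenerator.tendsto_gridMoment [IsProbabilityMeasure P]
    (hQ : IsMarkovChainWithGenerator G P Q) (t : ℝ≥0) :
    Tendsto (fun m : ℕ => (gridMoment P Q (fun k => k * (t / 2 ^ m)) 0 (2 ^ m),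
      gridMoment P Q (fun k => k * (t / 2 ^ m)) 1 (2 ^ m),
      gridMoment P Q (fun k => k * (t / 2 ^ m)) 2 (2 ^ m))) atTop
      (𝓝 (momentFlow G P Q t)) := by
  have hN : Tendsto (fun m : ℕ => 2 ^ m) atTop atTop :=
    tendsto_pow_atTop_atTop_of_one_lt one_lt_two
  have h1 := (tendsto_momentStep_exp_pow G t.2 hN)
  have h2 := ((ContinuousLinearMap.apply ℝ (MomentSpace J)
    (initialMoments P Q)).continuous.tendsto _).comp h1
  refine h2.congr fun m => ?_
  rw [hQ.gridMoment_eq_pow]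
  have hc : ((t / 2 ^ m : ℝ≥0) : ℝ) = (t : ℝ) / ((2 ^ m : ℕ) : ℝ) := by push_cast; rfl
  rw [hc]
  rfl

end Moments

/-! ### From grids to continuous time -/

/-- The number of deaths in `(0, t]` as a natural number. -/
noncomputable def jumpCount {J : ℕ} {Ω : Type*} (Q : ℝ≥0 → Ω → Fin (J + 1)) (t : ℝ≥0) (ω : Ω) : ℕ :=
  (downJumps (fun s => Q s ω) 0 t).ncard

theorem deathCount_eq_jumpCount {J : ℕ} {Ω : Type*} (Q : ℝ≥0 → Ω → Fin (J + 1)) (t : ℝ≥0) :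
    deathCount Q t = fun ω => (jumpCount Q t ω : ℝ) := rfl

section ContinuousTime

variable {J : ℕ} {G : Matrix (Fin (J + 1)) (Fin (J + 1)) ℝ} {Ω : Type*} [MeasurableSpace Ω]
  {P : Measure Ω} {Q : ℝ≥0 → Ω → Fin (J + 1)}

/-- The number of down steps along the dyadic grid of level `m` on `[0, t]`. -/
noncomputable def dyadicCount (Q : ℝ≥0 → Ω → Fin (J + 1)) (t : ℝ≥0) (m : ℕ) (ω : Ω) : ℕ :=
  downCount (fun k => Q (k * (t / 2 ^ m)) ω) (2 ^ m)

theorem IsMarkovChainWithGenerator.eventually_dyadicCount_eq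
    (hQ : IsMarkovChainWithGenerator G P Q) (t : ℝ≥0) (ω : Ω) :
    ∀ᶠ m in atTop, dyadicCount Q t m ω = jumpCount Q t ω :=
  eventually_downCount_dyadic_eq (hQ.right_continuous ω) (hQ.left_limit ω) t

theorem IsMarkovChainWithGenerator.dyadicCount_le
    (hQ : IsMarkovChainWithGenerator G P Q) (t : ℝ≥0) (m : ℕ) (ω : Ω) :
    dyadicCount Q t m ω ≤ jumpCount Q t ω :=
  downCount_dyadic_le (hQ.right_continuous ω) (hQ.left_limit ω) t m

theorem IsMarkovChainWithGenerator.measurable_dyadicCount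
    (hQ : IsMarkovChainWithGenerator G P Q) (t : ℝ≥0) (m : ℕ) : Measurable (dyadicCount Q t m) :=
  hQ.measurable_downCount (fun k => k * (t / 2 ^ m)) (2 ^ m)

theorem IsMarkovChainWithGenerator.measurable_deathCount
    (hQ : IsMarkovChainWithGenerator G P Q) (t : ℝ≥0) : Measurable (deathCount Q t) := by
  refine measurable_of_tendsto_metrizable (f := fun m ω => (dyadicCount Q t m ω : ℝ))
    (fun m => measurable_from_nat.comp (hQ.measurable_dyadicCount t m)) ?_
  refine tendsto_pi_nhds.2 fun ω => tendsto_const_nhds.congr' ?_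
  filter_upwards [hQ.eventually_dyadicCount_eq t ω] with m hm
  rw [hm, deathCount_eq_jumpCount]

theorem gridMoment_dyadic (P : Measure Ω) (Q : ℝ≥0 → Ω → Fin (J + 1)) (t : ℝ≥0) (r m : ℕ)
    (j : Fin (J + 1)) :
    gridMoment P Q (fun k => k * (t / 2 ^ m)) r (2 ^ m) j =
      ∫ ω, ((dyadicCount Q t m ω).choose r : ℝ) * (if Q t ω = j then 1 else 0) ∂P := by
  have heq : ((2 ^ m : ℕ) : ℝ≥0) * (t / 2 ^ m) = t := by
    push_cast; field_simp
  simp only [gridMoment, dyadicCount, heq]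

theorem Nat.cast_choose_le_one_add_sq (n : ℕ) {r : ℕ} (hr : r ≤ 2) :
    (n.choose r : ℝ) ≤ 1 + (n : ℝ) ^ 2 := by
  have h : n.choose r ≤ 1 + n ^ 2 := by
    refine (Nat.choose_le_pow n r).trans ?_
    interval_cases r
    · simp
    · nlinarith [Nat.le_self_pow two_ne_zero n]
    · simp
  exact_mod_cast h

theorem Nat.cast_sq_eq_choose (n : ℕ) :
    (n : ℝ) ^ 2 = (n.choose 1 : ℝ) + 2 * (n.choose 2 : ℝ) := by
  rw [Nat.cast_choose_two, Nat.choose_one_right]; ring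

theorem IsMarkovChainWithGenerator.integrable_choose_dyadicCount [IsProbabilityMeasure P]
    (hQ : IsMarkovChainWithGenerator G P Q) (t : ℝ≥0) (m r : ℕ) (j : Fin (J + 1)) :
    Integrable (fun ω => ((dyadicCount Q t m ω).choose r : ℝ) * (if Q t ω = j then 1 else 0)) P :=
  hQ.integrable_choose_downCount (fun k => k * (t / 2 ^ m)) r (2 ^ m) _
    (hQ.measurable_ite t (· = j)) fun ω => by split_ifs <;> simp

/-- Fatou: the dyadic counts are eventually equal to the death count, and their second moments
converge to a value read off from the moment flow. -/
theorem IsMarkovChainWithGenerator.memLp_deathCount [IsProbabilityMeasure P]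
    (hQ : IsMarkovChainWithGenerator G P Q) (t : ℝ≥0) : MemLp (deathCount Q t) 2 P := by
  have hmeas := hQ.measurable_deathCount t
  rw [memLp_two_iff_integrable_sq hmeas.aestronglyMeasurable]
  refine ⟨(hmeas.pow_const 2).aestronglyMeasurable, ?_⟩
  have hdecomp : ∀ m ω, (dyadicCount Q t m ω : ℝ) ^ 2 =
      ∑ j, (((dyadicCount Q t m ω).choose 1 : ℝ) * (if Q t ω = j then 1 else 0) +
        2 * (((dyadicCount Q t m ω).choose 2 : ℝ) * (if Q t ω = j then 1 else 0))) := by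
    intro m ω
    rw [Finset.sum_add_distrib, ← Finset.mul_sum, ← Finset.mul_sum, ← Finset.mul_sum,
      Nat.cast_sq_eq_choose]
    simp
  have hint : ∀ m, Integrable (fun ω => (dyadicCount Q t m ω : ℝ) ^ 2) P := by
    intro m
    simp_rw [hdecomp m]
    exact integrable_finsetSum _ fun j _ => (hQ.integrable_choose_dyadicCount t m 1 j).add
      ((hQ.integrable_choose_dyadicCount t m 2 j).const_mul 2)
  have hval : ∀ m, ∫ ω, (dyadicCount Q t m ω : ℝ) ^ 2 ∂P =
      ∑ j, (gridMoment P Q (fun k => k * (t / 2 ^ m)) 1 (2 ^ m) j +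
        2 * gridMoment P Q (fun k => k * (t / 2 ^ m)) 2 (2 ^ m) j) := by
    intro m
    simp_rw [hdecomp m, gridMoment_dyadic]
    rw [integral_finsetSum]
    · refine Finset.sum_congr rfl fun j _ => ?_
      rw [integral_add (hQ.integrable_choose_dyadicCount t m 1 j)
        ((hQ.integrable_choose_dyadicCount t m 2 j).const_mul 2), integral_const_mul]
    · exact fun j _ => (hQ.integrable_choose_dyadicCount t m 1 j).add
        ((hQ.integrable_choose_dyadicCount t m 2 j).const_mul 2)
  obtain ⟨c, hc⟩ : ∃ c, Tendsto (fun m => ∫ ω, (dyadicCount Q t m ω : ℝ) ^ 2 ∂P) atTop (𝓝 c) := by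
    simp_rw [hval]
    have h := (hQ.tendsto_gridMoment t).snd_nhds
    exact ⟨_, tendsto_finsetSum _ fun j _ =>
      (tendsto_pi_nhds.1 h.fst_nhds j).add ((tendsto_pi_nhds.1 h.snd_nhds j).const_mul 2)⟩
  have hlim : ∀ ω, liminf (fun m => ‖(dyadicCount Q t m ω : ℝ) ^ 2‖ₑ) atTop =
      ‖deathCount Q t ω ^ 2‖ₑ := fun ω => by
    refine (tendsto_const_nhds.congr' ?_).liminf_eq
    filter_upwards [hQ.eventually_dyadicCount_eq t ω] with m hm
    rw [hm, deathCount_eq_jumpCount]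
  have hfatou := lintegral_liminf_le (μ := P) (u := atTop)
    (f := fun m ω => ‖(dyadicCount Q t m ω : ℝ) ^ 2‖ₑ)
    fun m => ((measurable_from_nat.comp (hQ.measurable_dyadicCount t m)).pow_const 2).enorm
  simp_rw [hlim] at hfatou
  refine lt_of_le_of_lt hfatou ?_
  have heq : ∀ m, ∫⁻ ω, ‖(dyadicCount Q t m ω : ℝ) ^ 2‖ₑ ∂P =
      ENNReal.ofReal (∫ ω, (dyadicCount Q t m ω : ℝ) ^ 2 ∂P) := by
    intro m
    rw [← ofReal_integral_norm_eq_lintegral_enorm (hint m)]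
    simp
  simp_rw [heq]
  rw [(ENNReal.tendsto_ofReal hc).liminf_eq]
  exact ENNReal.ofReal_lt_top

/-- Dominated convergence: dyadic counts never exceed the death count N, so 1 + N², integrable by
the previous Fatou argument, dominates for r ≤ 2. -/
theorem IsMarkovChainWithGenerator.tendsto_integral_choose_dyadicCount [IsProbabilityMeasure P]
    (hQ : IsMarkovChainWithGenerator G P Q) (t : ℝ≥0) {r : ℕ} (hr : r ≤ 2) (j : Fin (J + 1)) :
    Tendsto (fun m => gridMoment P Q (fun k => k * (t / 2 ^ m)) r (2 ^ m) j) atTop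
      (𝓝 (∫ ω, ((jumpCount Q t ω).choose r : ℝ) * (if Q t ω = j then 1 else 0) ∂P)) := by
  simp_rw [gridMoment_dyadic]
  refine tendsto_integral_of_dominated_convergence (fun ω => 1 + deathCount Q t ω ^ 2)
    (fun m => (hQ.integrable_choose_dyadicCount t m r j).aestronglyMeasurable)
    ((integrable_const 1).add (hQ.memLp_deathCount t).integrable_sq) ?_ ?_
  · refine fun m => Eventually.of_forall fun ω => ?_
    have h1 : ((dyadicCount Q t m ω).choose r : ℝ) ≤ (jumpCount Q t ω).choose r := by
      exact_mod_cast Nat.choose_le_choose r (hQ.dyadicCount_le t m ω)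
    have h2 := h1.trans (Nat.cast_choose_le_one_add_sq _ hr)
    rw [deathCount_eq_jumpCount, Real.norm_eq_abs, abs_mul, Nat.abs_cast]
    split_ifs
    · simpa using h2
    · rw [abs_zero, mul_zero]; positivity
  · refine Eventually.of_forall fun ω => tendsto_const_nhds.congr' ?_
    filter_upwards [hQ.eventually_dyadicCount_eq t ω] with m hm
    rw [hm]

theorem IsMarkovChainWithGenerator.integrable_choose_jumpCount [IsProbabilityMeasure P]
    (hQ : IsMarkovChainWithGenerator G P Q) (t : ℝ≥0) {r : ℕ} (hr : r ≤ 2) (j : Fin (J + 1)) :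
    Integrable (fun ω => ((jumpCount Q t ω).choose r : ℝ) * (if Q t ω = j then 1 else 0)) P := by
  refine ((integrable_const 1).add (hQ.memLp_deathCount t).integrable_sq).mono' ?_ ?_
  · have h1 : Measurable (jumpCount Q t) := by
      have := (hQ.measurable_deathCount t).nat_floor
      simpa [deathCount_eq_jumpCount] using this
    exact (((measurable_of_countable (fun n : ℕ => (n.choose r : ℝ))).comp h1).mul
      (hQ.measurable_ite t (· = j))).aestronglyMeasurable
  · refine Eventually.of_forall fun ω => ?_
    have h2 := Nat.cast_choose_le_one_add_sq (jumpCount Q t ω) hr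
    rw [Real.norm_eq_abs, abs_mul, Nat.abs_cast, Pi.add_apply, deathCount_eq_jumpCount]
    split_ifs
    · simpa using h2
    · rw [abs_zero, mul_zero]; positivity

theorem IsMarkovChainWithGenerator.integral_choose_jumpCount_mul [IsProbabilityMeasure P]
    (hQ : IsMarkovChainWithGenerator G P Q) (t : ℝ≥0) {r : ℕ} (hr : r ≤ 2) (f : Fin (J + 1) → ℝ) :
    ∫ ω, ((jumpCount Q t ω).choose r : ℝ) * f (Q t ω) ∂P =
      (fun j => ∫ ω, ((jumpCount Q t ω).choose r : ℝ) * (if Q t ω = j then 1 else 0) ∂P) ⬝ᵥ f := by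
  have h : ∀ ω, ((jumpCount Q t ω).choose r : ℝ) * f (Q t ω) =
      ∑ j, (((jumpCount Q t ω).choose r : ℝ) * (if Q t ω = j then 1 else 0)) * f j := by
    intro ω; simp
  simp_rw [h]
  rw [integral_finsetSum _ fun j _ => (hQ.integrable_choose_jumpCount t hr j).mul_const _]
  exact Finset.sum_congr rfl fun j _ => integral_mul_const _ _

/-- The dyadic moments converge both to the true moment and to the flow, so the two agree. The next
results do the same for orders 1 and 2. -/
theorem IsMarkovChainWithGenerator.integral_state [IsProbabilityMeasure P]
    (hQ : IsMarkovChainWithGenerator G P Q) (t : ℝ≥0) (f : Fin (J + 1) → ℝ) :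
    ∫ ω, f (Q t ω) ∂P = (momentFlow G P Q t).1 ⬝ᵥ f := by
  have h := hQ.integral_choose_jumpCount_mul t (r := 0) (by norm_num) f
  simp only [Nat.choose_zero_right, Nat.cast_one, one_mul] at h
  rw [h]
  congr 1
  funext j
  have h1 := hQ.tendsto_integral_choose_dyadicCount t (r := 0) (by norm_num) j
  simp only [Nat.choose_zero_right, Nat.cast_one, one_mul] at h1
  exact tendsto_nhds_unique h1 (tendsto_pi_nhds.1 (hQ.tendsto_gridMoment t).fst_nhds j)

theorem IsMarkovChainWithGenerator.integral_deathCount_mul_state [IsProbabilityMeasure P]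
    (hQ : IsMarkovChainWithGenerator G P Q) (t : ℝ≥0) (f : Fin (J + 1) → ℝ) :
    ∫ ω, deathCount Q t ω * f (Q t ω) ∂P = (momentFlow G P Q t).2.1 ⬝ᵥ f := by
  have h := hQ.integral_choose_jumpCount_mul t (r := 1) (by norm_num) f
  have h1 := fun j => hQ.tendsto_integral_choose_dyadicCount t (r := 1) (by norm_num) j
  simp only [Nat.choose_one_right] at h h1
  rw [deathCount_eq_jumpCount, h]
  congr 1
  funext j
  exact tendsto_nhds_unique (h1 j)
    (tendsto_pi_nhds.1 (hQ.tendsto_gridMoment t).snd_nhds.fst_nhds j)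

theorem IsMarkovChainWithGenerator.integral_deathCount [IsProbabilityMeasure P]
    (hQ : IsMarkovChainWithGenerator G P Q) (t : ℝ≥0) :
    ∫ ω, deathCount Q t ω ∂P = (momentFlow G P Q t).2.1 ⬝ᵥ 1 := by
  simpa using hQ.integral_deathCount_mul_state t 1

theorem IsMarkovChainWithGenerator.integral_deathCount_sq [IsProbabilityMeasure P]
    (hQ : IsMarkovChainWithGenerator G P Q) (t : ℝ≥0) :
    ∫ ω, deathCount Q t ω ^ 2 ∂P =
      (momentFlow G P Q t).2.1 ⬝ᵥ 1 + 2 * ((momentFlow G P Q t).2.2 ⬝ᵥ 1) := by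
  have h := hQ.integral_choose_jumpCount_mul t (r := 2) le_rfl 1
  have h1 : (fun j => ∫ ω, ((jumpCount Q t ω).choose 2 : ℝ) * (if Q t ω = j then 1 else 0) ∂P) =
      (momentFlow G P Q t).2.2 := by
    funext j
    exact tendsto_nhds_unique (hQ.tendsto_integral_choose_dyadicCount t le_rfl j)
      (tendsto_pi_nhds.1 (hQ.tendsto_gridMoment t).snd_nhds.snd_nhds j)
  simp only [Pi.one_apply, mul_one] at h
  have hsq : Integrable (fun ω => deathCount Q t ω ^ 2) P := (hQ.memLp_deathCount t).integrable_sq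
  have hone : Integrable (deathCount Q t) P := (hQ.memLp_deathCount t).integrable one_le_two
  have h2 : ∀ ω, ((jumpCount Q t ω).choose 2 : ℝ) =
      2⁻¹ * (deathCount Q t ω ^ 2 - deathCount Q t ω) := by
    intro ω
    rw [Nat.cast_choose_two, deathCount_eq_jumpCount]; ring
  rw [h1] at h
  simp_rw [h2] at h
  rw [integral_const_mul, integral_sub hsq hone, hQ.integral_deathCount] at h
  linarith

theorem hasDerivAt_momentFlow (G : Matrix (Fin (J + 1)) (Fin (J + 1)) ℝ) (P : Measure Ω)
    (Q : ℝ≥0 → Ω → Fin (J + 1)) (t : ℝ) :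
    HasDerivAt (momentFlow G P Q) (momentStep G (momentFlow G P Q t)) t := by
  have h := hasDerivAt_exp_smul_const' (𝕂 := ℝ) (momentStep G) t
  exact (ContinuousLinearMap.apply ℝ (MomentSpace J)
    (initialMoments P Q)).hasFDerivAt.comp_hasDerivAt t h

theorem hasDerivAt_momentFlow_functional (G : Matrix (Fin (J + 1)) (Fin (J + 1)) ℝ)
    (P : Measure Ω) (Q : ℝ≥0 → Ω → Fin (J + 1)) (ℓ : MomentSpace J →ₗ[ℝ] ℝ) (t : ℝ) :
    HasDerivAt (fun t => ℓ (momentFlow G P Q t)) (ℓ (momentStep G (momentFlow G P Q t))) t :=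
  (LinearMap.toContinuousLinearMap ℓ).hasFDerivAt.comp_hasDerivAt t
    (hasDerivAt_momentFlow G P Q t)

/-- Kolmogorov's equation with G moved onto the test function, the form into which a Poisson
equation can be substituted; likewise for the two higher orders. -/
theorem hasDerivAt_stateMoment (G : Matrix (Fin (J + 1)) (Fin (J + 1)) ℝ) (P : Measure Ω)
    (Q : ℝ≥0 → Ω → Fin (J + 1)) (f : Fin (J + 1) → ℝ) (t : ℝ) :
    HasDerivAt (fun t => (momentFlow G P Q t).1 ⬝ᵥ f) ((momentFlow G P Q t).1 ⬝ᵥ (G *ᵥ f)) t := by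
  have h := hasDerivAt_momentFlow_functional G P Q
    { toFun := fun v => v.1 ⬝ᵥ f
      map_add' := fun v w => by simp [add_dotProduct]
      map_smul' := fun c v => by simp } t
  rw [Matrix.dotProduct_mulVec]
  exact h

theorem hasDerivAt_firstMoment (G : Matrix (Fin (J + 1)) (Fin (J + 1)) ℝ) (P : Measure Ω)
    (Q : ℝ≥0 → Ω → Fin (J + 1)) (f : Fin (J + 1) → ℝ) (t : ℝ) :
    HasDerivAt (fun t => (momentFlow G P Q t).2.1 ⬝ᵥ f)
      ((momentFlow G P Q t).2.1 ⬝ᵥ (G *ᵥ f) + (momentFlow G P Q t).1 ⬝ᵥ (lowerPart G *ᵥ f)) t := by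
  have h := hasDerivAt_momentFlow_functional G P Q
    { toFun := fun v => v.2.1 ⬝ᵥ f
      map_add' := fun v w => by simp [add_dotProduct]
      map_smul' := fun c v => by simp } t
  rw [Matrix.dotProduct_mulVec, Matrix.dotProduct_mulVec, ← add_dotProduct]
  exact h

theorem hasDerivAt_secondMoment (G : Matrix (Fin (J + 1)) (Fin (J + 1)) ℝ) (P : Measure Ω)
    (Q : ℝ≥0 → Ω → Fin (J + 1)) (f : Fin (J + 1) → ℝ) (t : ℝ) :
    HasDerivAt (fun t => (momentFlow G P Q t).2.2 ⬝ᵥ f)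
      ((momentFlow G P Q t).2.2 ⬝ᵥ (G *ᵥ f) + (momentFlow G P Q t).2.1 ⬝ᵥ (lowerPart G *ᵥ f)) t := by
  have h := hasDerivAt_momentFlow_functional G P Q
    { toFun := fun v => v.2.2 ⬝ᵥ f
      map_add' := fun v w => by simp [add_dotProduct]
      map_smul' := fun c v => by simp } t
  rw [Matrix.dotProduct_mulVec, Matrix.dotProduct_mulVec, ← add_dotProduct]
  exact h

end ContinuousTime

/-! ### Asymptotic mean and variance from Poisson equations -/

/-- A self-bounding estimate: 2A√V ≤ V/2 + 2A² first gives V = O(t), and then the error term is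
O(√t). -/
theorem tendsto_div_of_abs_sub_le_sqrt {V : ℝ≥0 → ℝ} {γ A C : ℝ} (hA : 0 ≤ A) (hC : 0 ≤ C)
    (hV : ∀ t, 0 ≤ V t) (h : ∀ t : ℝ≥0, |V t - γ * t| ≤ 2 * A * √(V t) + C) :
    Tendsto (fun t : ℝ≥0 => V t / t) atTop (𝓝 γ) := by
  set K : ℝ := 2 * |γ| + 4 * A ^ 2 + 2 * C with hK
  have hK0 : 0 ≤ K := by positivity
  have hbound : ∀ t : ℝ≥0, 1 ≤ t → |V t / t - γ| ≤ (2 * A * √(2 * K) + C) / √(t : ℝ) := by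
    intro t ht
    have ht : (1 : ℝ) ≤ t := by exact_mod_cast ht
    have ht0 : (0 : ℝ) < t := by linarith
    have h1 := h t
    have hs := Real.sq_sqrt (hV t)
    have hVle : V t ≤ 2 * K * t := by
      have h2 := (abs_le.1 h1).2
      have h3 : 2 * A * √(V t) ≤ V t / 2 + 2 * A ^ 2 := by nlinarith [sq_nonneg (√(V t) - 2 * A)]
      have h4 : γ * t ≤ |γ| * t := by gcongr; exact le_abs_self γ
      nlinarith [abs_nonneg γ, sq_nonneg A]
    have hsqrt : √(V t) ≤ √(2 * K) * √(t : ℝ) := by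
      rw [← Real.sqrt_mul (by positivity)]
      exact Real.sqrt_le_sqrt hVle
    have hts : √(t : ℝ) * √(t : ℝ) = t := Real.mul_self_sqrt ht0.le
    have hs1 : 1 ≤ √(t : ℝ) := Real.one_le_sqrt.2 ht
    have heq : V t / t - γ = (V t - γ * t) / t := by field_simp
    rw [heq, abs_div, abs_of_pos ht0, div_le_div_iff₀ ht0 (by linarith)]
    calc |V t - γ * t| * √(t : ℝ) ≤ (2 * A * (√(2 * K) * √(t : ℝ)) + C * √(t : ℝ)) * √(t : ℝ) := by
          gcongr
          refine h1.trans (add_le_add (by gcongr) ?_)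
          nlinarith
      _ = (2 * A * √(2 * K) + C) * (√(t : ℝ) * √(t : ℝ)) := by ring
      _ = _ := by rw [hts]
  have hlim : Tendsto (fun t : ℝ≥0 => (2 * A * √(2 * K) + C) / √(t : ℝ)) atTop (𝓝 0) :=
    (Real.tendsto_sqrt_atTop.comp (NNReal.tendsto_coe_atTop.2 tendsto_id)).const_div_atTop _
  rw [tendsto_iff_norm_sub_tendsto_zero]
  refine squeeze_zero' (Eventually.of_forall fun _ => norm_nonneg _) ?_ hlim
  filter_upwards [eventually_ge_atTop 1] with t ht using hbound t ht

/-- Cauchy–Schwarz, from the discriminant of the nonnegative quadratic c ↦ Var(X + cY). -/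
theorem sq_covariance_le {Ω : Type*} [MeasurableSpace Ω] {P : Measure Ω} [IsProbabilityMeasure P]
    {X Y : Ω → ℝ} (hX : MemLp X 2 P) (hY : MemLp Y 2 P) :
    cov[X, Y; P] ^ 2 ≤ variance X P * variance Y P := by
  have h : ∀ c : ℝ, 0 ≤ variance Y P * (c * c) + (2 * cov[X, Y; P]) * c + variance X P := by
    intro c
    have h1 := variance_nonneg (X + c • Y) P
    rw [variance_add hX (hY.const_smul c), variance_smul, covariance_smul_right] at h1
    linarith
  have := discrim_le_zero h
  rw [discrim] at this
  linarith

theorem eq_of_forall_hasDerivAt_zero {w : ℝ → ℝ} (h : ∀ t, HasDerivAt w 0 t) (s t : ℝ) :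
    w s = w t :=
  is_const_of_deriv_eq_zero (fun t => (h t).differentiableAt) (fun t => (h t).deriv) s t

section Asymptotics

variable {J : ℕ} {G : Matrix (Fin (J + 1)) (Fin (J + 1)) ℝ} {Ω : Type*} [MeasurableSpace Ω]
  {P : Measure Ω} {Q : ℝ≥0 → Ω → Fin (J + 1)}

theorem abs_le_sum_abs {ι : Type*} [Fintype ι] (f : ι → ℝ) (i : ι) : |f i| ≤ ∑ j, |f j| :=
  Finset.single_le_sum (f := fun j => |f j|) (fun _ _ => abs_nonneg _) (Finset.mem_univ i)

theorem IsMarkovChainWithGenerator.memLp_state [IsProbabilityMeasure P]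
    (hQ : IsMarkovChainWithGenerator G P Q) (t : ℝ≥0) (f : Fin (J + 1) → ℝ) :
    MemLp (fun ω => f (Q t ω)) 2 P :=
  MemLp.of_bound ((measurable_of_countable f).comp (hQ.measurable t)).aestronglyMeasurable
    (∑ j, |f j|) (Eventually.of_forall fun _ => abs_le_sum_abs f _)

theorem IsMarkovChainWithGenerator.abs_stateMoment_le [IsProbabilityMeasure P]
    (hQ : IsMarkovChainWithGenerator G P Q) (t : ℝ≥0) (f : Fin (J + 1) → ℝ) :
    |(momentFlow G P Q t).1 ⬝ᵥ f| ≤ ∑ j, |f j| := by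
  rw [← hQ.integral_state]
  simpa using norm_integral_le_of_norm_le_const (μ := P) (f := fun ω => f (Q t ω))
    (Eventually.of_forall fun ω => abs_le_sum_abs f (Q t ω))

theorem IsMarkovChainWithGenerator.variance_state_le [IsProbabilityMeasure P]
    (hQ : IsMarkovChainWithGenerator G P Q) (t : ℝ≥0) (f : Fin (J + 1) → ℝ) :
    variance (fun ω => f (Q t ω)) P ≤ (∑ j, |f j|) ^ 2 := by
  refine (variance_le_expectation_sq
    (hQ.memLp_state t f).aestronglyMeasurable).trans ?_
  have h := norm_integral_le_of_norm_le_const (μ := P) (f := fun ω => f (Q t ω) ^ 2)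
    (C := (∑ j, |f j|) ^ 2) (Eventually.of_forall fun ω => by
      rw [norm_pow]
      exact pow_le_pow_left₀ (norm_nonneg _) (abs_le_sum_abs f _) 2)
  simpa using (le_abs_self _).trans h

/-- If `f` solves the Poisson equation for the death rates, with mean rate `a`, and `ψ` solves the
Poisson equation for the resulting variance rate, with mean `γ`, then the asymptotic
variance-to-mean ratio of the number of deaths is `γ / a`. -/
theorem IsMarkovChainWithGenerator.hasAsymptoticRatio_of_poisson [IsProbabilityMeasure P]
    (hQ : IsMarkovChainWithGenerator G P Q) {f ψ : Fin (J + 1) → ℝ} {a γ : ℝ} (ha : 0 < a)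
    (hrow : G *ᵥ 1 = 0) (hf : G *ᵥ f = lowerPart G *ᵥ 1 - a • 1)
    (hψ : G *ᵥ ψ = (2 * a) • f + lowerPart G *ᵥ 1 - (2 : ℝ) • (lowerPart G *ᵥ f) - γ • 1) :
    HasAsymptoticRatio P Q (γ / a) := by
  set m := momentFlow G P Q with hm
  have hone : ∀ t, (m t).1 ⬝ᵥ 1 = 1 := by
    intro t
    have h : ∀ t, HasDerivAt (fun t => (m t).1 ⬝ᵥ 1) 0 t := by
      intro t
      simpa [hrow] using hasDerivAt_stateMoment G P Q 1 t
    rw [eq_of_forall_hasDerivAt_zero h t (0 : ℝ≥0), hm, ← hQ.integral_state]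
    simp
  have hx : ∀ t, HasDerivAt (fun t => (m t).1 ⬝ᵥ f) ((m t).1 ⬝ᵥ (lowerPart G *ᵥ 1) - a) t := by
    intro t
    have h := hasDerivAt_stateMoment G P Q f t
    rw [hf, dotProduct_sub, dotProduct_smul, ← hm, hone] at h
    simpa using h
  have hM : ∀ t, HasDerivAt (fun t => (m t).2.1 ⬝ᵥ 1) ((m t).1 ⬝ᵥ (lowerPart G *ᵥ 1)) t := by
    intro t
    have h := hasDerivAt_firstMoment G P Q 1 t
    rwa [hrow, dotProduct_zero, zero_add] at h
  have hc : ∀ t, HasDerivAt (fun t => (m t).2.1 ⬝ᵥ f) ((m t).2.1 ⬝ᵥ (lowerPart G *ᵥ 1) -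
      a * ((m t).2.1 ⬝ᵥ 1) + (m t).1 ⬝ᵥ (lowerPart G *ᵥ f)) t := by
    intro t
    have h := hasDerivAt_firstMoment G P Q f t
    rwa [hf, dotProduct_sub, dotProduct_smul] at h
  have hs : ∀ t, HasDerivAt (fun t => (m t).2.2 ⬝ᵥ 1) ((m t).2.1 ⬝ᵥ (lowerPart G *ᵥ 1)) t := by
    intro t
    have h := hasDerivAt_secondMoment G P Q 1 t
    rwa [hrow, dotProduct_zero, zero_add] at h
  have hy : ∀ t, HasDerivAt (fun t => (m t).1 ⬝ᵥ ψ) (2 * a * ((m t).1 ⬝ᵥ f) +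
      (m t).1 ⬝ᵥ (lowerPart G *ᵥ 1) - 2 * ((m t).1 ⬝ᵥ (lowerPart G *ᵥ f)) - γ) t := by
    intro t
    have h := hasDerivAt_stateMoment G P Q ψ t
    rw [hψ, dotProduct_sub, dotProduct_sub, dotProduct_add, dotProduct_smul, dotProduct_smul,
      dotProduct_smul, ← hm, hone] at h
    simpa using h
  have hmeanconst : ∀ t s : ℝ, (m t).2.1 ⬝ᵥ 1 - (m t).1 ⬝ᵥ f - a * t =
      (m s).2.1 ⬝ᵥ 1 - (m s).1 ⬝ᵥ f - a * s := by
    refine eq_of_forall_hasDerivAt_zero fun t => ?_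
    exact (((hM t).sub (hx t)).sub ((hasDerivAt_id t).const_mul a)).congr_deriv (by ring)
  -- This is Var N − 2 Cov(N, f(Q)) − (E f(Q))² − E ψ(Q) − γt. The Poisson equation for f removes
  -- the growing terms in E[N L1] and E N from the derivative, and ψ is chosen to absorb what
  -- remains, which depends on the current state only.
  have hvarconst : ∀ t s : ℝ,
      (m t).2.1 ⬝ᵥ 1 + 2 * ((m t).2.2 ⬝ᵥ 1) - ((m t).2.1 ⬝ᵥ 1) ^ 2
        - 2 * ((m t).2.1 ⬝ᵥ f - ((m t).2.1 ⬝ᵥ 1) * ((m t).1 ⬝ᵥ f))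
        - ((m t).1 ⬝ᵥ f) ^ 2 - (m t).1 ⬝ᵥ ψ - γ * t =
      (m s).2.1 ⬝ᵥ 1 + 2 * ((m s).2.2 ⬝ᵥ 1) - ((m s).2.1 ⬝ᵥ 1) ^ 2
        - 2 * ((m s).2.1 ⬝ᵥ f - ((m s).2.1 ⬝ᵥ 1) * ((m s).1 ⬝ᵥ f))
        - ((m s).1 ⬝ᵥ f) ^ 2 - (m s).1 ⬝ᵥ ψ - γ * s := by
    refine eq_of_forall_hasDerivAt_zero fun t => ?_
    refine HasDerivAt.congr_deriv (((((((hM t).add ((hs t).const_mul 2)).sub ((hM t).pow 2)).sub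
      (((hc t).sub ((hM t).mul (hx t))).const_mul 2)).sub ((hx t).pow 2)).sub (hy t)).sub
      ((hasDerivAt_id t).const_mul γ)) ?_
    push_cast
    ring
  have hL2 := hQ.memLp_deathCount
  have hmean : ∀ t : ℝ≥0, ∫ ω, deathCount Q t ω ∂P = (m t).2.1 ⬝ᵥ 1 := hQ.integral_deathCount
  have hvar : ∀ t : ℝ≥0, variance (deathCount Q t) P =
      (m t).2.1 ⬝ᵥ 1 + 2 * ((m t).2.2 ⬝ᵥ 1) - ((m t).2.1 ⬝ᵥ 1) ^ 2 := by
    intro t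
    rw [variance_eq_sub (hL2 t), hmean]
    congr 1
    exact hQ.integral_deathCount_sq t
  have hcov : ∀ t : ℝ≥0, cov[deathCount Q t, fun ω => f (Q t ω); P] =
      (m t).2.1 ⬝ᵥ f - ((m t).2.1 ⬝ᵥ 1) * ((m t).1 ⬝ᵥ f) := by
    intro t
    rw [covariance_eq_sub (hL2 t) (hQ.memLp_state t f), hmean, hQ.integral_state]
    congr 1
    exact hQ.integral_deathCount_mul_state t f
  set A := ∑ j, |f j| with hA
  have hA0 : 0 ≤ A := Finset.sum_nonneg fun _ _ => abs_nonneg _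
  set B := ∑ j, |ψ j| with hB
  have hB0 : 0 ≤ B := Finset.sum_nonneg fun _ _ => abs_nonneg _
  -- The covariance need not be shown bounded: O(√Var N) is enough for
  -- `tendsto_div_of_abs_sub_le_sqrt`.
  have hcovle : ∀ t : ℝ≥0, |cov[deathCount Q t, fun ω => f (Q t ω); P]| ≤
      A * √(variance (deathCount Q t) P) := by
    intro t
    have h1 := sq_covariance_le (hL2 t) (hQ.memLp_state t f)
    have h2 := hQ.variance_state_le t f
    have h3 := variance_nonneg (deathCount Q t) P
    refine abs_le_of_sq_le_sq ?_ (by positivity)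
    rw [mul_pow, Real.sq_sqrt h3]
    nlinarith
  have hVlim : Tendsto (fun t : ℝ≥0 => variance (deathCount Q t) P / t) atTop (𝓝 γ) := by
    set w0 := (m 0).2.1 ⬝ᵥ 1 + 2 * ((m 0).2.2 ⬝ᵥ 1) - ((m 0).2.1 ⬝ᵥ 1) ^ 2
        - 2 * ((m 0).2.1 ⬝ᵥ f - ((m 0).2.1 ⬝ᵥ 1) * ((m 0).1 ⬝ᵥ f))
        - ((m 0).1 ⬝ᵥ f) ^ 2 - (m 0).1 ⬝ᵥ ψ - γ * 0 with hw0
    refine tendsto_div_of_abs_sub_le_sqrt (A := A) (C := A ^ 2 + B + |w0|) hA0 (by positivity)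
      (fun t => variance_nonneg _ _) fun t => ?_
    have h1 := hvarconst t 0
    rw [← hw0, ← hvar, ← hcov] at h1
    have h2 : |((m t).1 ⬝ᵥ f) ^ 2| ≤ A ^ 2 := by
      rw [abs_pow]
      exact pow_le_pow_left₀ (abs_nonneg _) (hQ.abs_stateMoment_le t f) 2
    have h3 : |(m t).1 ⬝ᵥ ψ| ≤ B := hQ.abs_stateMoment_le t ψ
    have h4 := hcovle t
    have h5 := le_abs_self w0
    have h6 := neg_abs_le w0
    rw [abs_le] at h2 h3 h4 ⊢
    constructor <;> linarith [h2.1, h2.2, h3.1, h3.2, h4.1, h4.2]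
  have hcoe : Tendsto (fun t : ℝ≥0 => (t : ℝ)) atTop atTop := NNReal.tendsto_coe_atTop.2 tendsto_id
  have hElim : Tendsto (fun t : ℝ≥0 => (∫ ω, deathCount Q t ω ∂P) / t) atTop (𝓝 a) := by
    set w0 := (m 0).2.1 ⬝ᵥ 1 - (m 0).1 ⬝ᵥ f - a * 0 with hw0
    rw [tendsto_iff_norm_sub_tendsto_zero]
    refine squeeze_zero' (Eventually.of_forall fun _ => norm_nonneg _) ?_
      (hcoe.const_div_atTop (A + |w0|))
    filter_upwards [eventually_gt_atTop 0] with t ht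
    have ht : (0 : ℝ) < t := by exact_mod_cast ht
    have h1 := hmeanconst t 0
    rw [← hw0, ← hmean] at h1
    have heq : (∫ ω, deathCount Q t ω ∂P) / t - a = ((m t).1 ⬝ᵥ f + w0) / t := by
      rw [← h1]; field_simp; ring
    rw [heq, norm_div, Real.norm_eq_abs, Real.norm_eq_abs, abs_of_pos ht]
    gcongr
    exact (abs_add_le _ _).trans (add_le_add_left (hQ.abs_stateMoment_le t f) _)
  refine ⟨hL2, ?_, ?_⟩
  · filter_upwards [hElim.eventually (lt_mem_nhds ha), eventually_gt_atTop 0] with t h1 h2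
    exact (div_pos_iff_of_pos_right (by exact_mod_cast h2)).1 h1
  · refine (hVlim.div hElim ha.ne').congr' ?_
    filter_upwards [eventually_gt_atTop 0] with t ht
    have ht : (t : ℝ) ≠ 0 := by exact_mod_cast ht.ne'
    simp only [Pi.div_apply]
    rw [div_div_div_cancel_right₀ ht]

end Asymptotics

/-! ### Detailed balance and Poisson equations for birth-death chains -/

section BirthDeath

variable {J : ℕ} {birth death : ℕ → ℝ}

theorem bdRate_mulVec (J : ℕ) (birth death f : ℕ → ℝ) (i : Fin (J + 1)) :
    ∑ k, bdRate J birth death i k * f k = (if (i : ℕ) < J then birth i * f (i + 1) else 0) +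
      if 0 < (i : ℕ) then death i * f (i - 1) else 0 := by
  simp only [bdRate, Matrix.of_apply]
  rw [Fin.sum_univ_eq_sum_range (fun k => (if k = (i : ℕ) + 1 then birth i
    else if (i : ℕ) = k + 1 then death i else 0) * f k)]
  have hsplit : ∀ k : ℕ, (if k = (i : ℕ) + 1 then birth i
      else if (i : ℕ) = k + 1 then death i else 0) * f k =
      (if k = (i : ℕ) + 1 then birth i * f (i + 1) else 0) +
      if k = (i : ℕ) - 1 then (if 0 < (i : ℕ) then death i * f (i - 1) else 0) else 0 := by
    intro k
    by_cases h1 : k = (i : ℕ) + 1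
    · have h2 : ¬ k = (i : ℕ) - 1 := by omega
      rw [if_pos h1, if_pos h1, if_neg h2, h1, add_zero]
    · rw [if_neg h1, if_neg h1, zero_add]
      by_cases h2 : (i : ℕ) = k + 1
      · have h3 : k = (i : ℕ) - 1 := by omega
        have h4 : 0 < (i : ℕ) := by omega
        rw [if_pos h2, if_pos h3, if_pos h4, h3]
      · rw [if_neg h2, zero_mul]
        by_cases h3 : k = (i : ℕ) - 1
        · have h4 : ¬ 0 < (i : ℕ) := by omega
          rw [if_pos h3, if_neg h4]
        · rw [if_neg h3]
  have hi := i.2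
  simp_rw [hsplit]
  rw [Finset.sum_add_distrib, Finset.sum_ite_eq', Finset.sum_ite_eq']
  congr 1
  · simp
  · rw [if_pos (Finset.mem_range.2 (by omega))]

theorem bdGenerator_mulVec (J : ℕ) (birth death f : ℕ → ℝ) (i : Fin (J + 1)) :
    (bdGenerator J birth death *ᵥ fun k => f k) i =
      (if (i : ℕ) < J then birth i * (f (i + 1) - f i) else 0) +
      if 0 < (i : ℕ) then death i * (f (i - 1) - f i) else 0 := by
  rw [bdGenerator, Matrix.sub_mulVec, Pi.sub_apply, Matrix.mulVec_diagonal]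
  have h1 := bdRate_mulVec J birth death f i
  have h2 := bdRate_mulVec J birth death (fun _ => 1) i
  simp only [mul_one] at h2
  rw [h2, Matrix.mulVec, dotProduct, h1]
  split_ifs <;> ring

theorem bdGenerator_mulVec_one (J : ℕ) (birth death : ℕ → ℝ) :
    bdGenerator J birth death *ᵥ 1 = 0 := by
  funext i
  refine (bdGenerator_mulVec J birth death (fun _ => 1) i).trans ?_
  simp

theorem lowerPart_bdGenerator (J : ℕ) (birth death : ℕ → ℝ) :
    lowerPart (bdGenerator J birth death) = bdRate J (fun _ => 0) death := by
  ext i j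
  simp only [lowerPart, bdGenerator, bdRate, Matrix.of_apply, Matrix.sub_apply,
    Matrix.diagonal_apply, Fin.lt_def, Fin.ext_iff]
  split_ifs <;> first | omega | simp

theorem lowerPart_bdGenerator_mulVec (J : ℕ) (birth death f : ℕ → ℝ) (i : Fin (J + 1)) :
    (lowerPart (bdGenerator J birth death) *ᵥ fun k => f k) i =
      if 0 < (i : ℕ) then death i * f (i - 1) else 0 := by
  rw [lowerPart_bdGenerator, Matrix.mulVec, dotProduct, bdRate_mulVec]
  simp

/-- Summation by parts for the generator of a birth-death chain. -/
theorem sum_mul_bdGenerator_mulVec (J : ℕ) (birth death p f : ℕ → ℝ) :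
    ∑ i : Fin (J + 1), p i * (bdGenerator J birth death *ᵥ fun k => f k) i =
      ∑ i ∈ Finset.range J, (p i * birth i - p (i + 1) * death (i + 1)) * (f (i + 1) - f i) := by
  simp_rw [bdGenerator_mulVec]
  rw [Fin.sum_univ_eq_sum_range (fun i => p i *
    ((if i < J then birth i * (f (i + 1) - f i) else 0) +
      if 0 < i then death i * (f (i - 1) - f i) else 0))]
  simp_rw [mul_add]
  rw [Finset.sum_add_distrib, Finset.sum_range_succ, Finset.sum_range_succ' _ J]
  simp only [lt_irrefl, if_false, mul_zero, add_zero, Nat.succ_pos, if_true, Nat.add_sub_cancel]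
  rw [← Finset.sum_add_distrib]
  refine Finset.sum_congr rfl fun i hi => ?_
  rw [if_pos (Finset.mem_range.1 hi)]
  ring

/-- A probability vector on `{0, …, J}`, indexed by `ℕ`, with positive entries and in detailed
balance. -/
structure IsReversing (J : ℕ) (birth death p : ℕ → ℝ) : Prop where
  pos : ∀ i ≤ J, 0 < p i
  sum_eq_one : ∑ i ∈ Finset.range (J + 1), p i = 1
  balance : ∀ i < J, p i * birth i = p (i + 1) * death (i + 1)

/-- The extension by zero of a vector on `{0, …, J}`. -/
def extendZero {J : ℕ} (π : Fin (J + 1) → ℝ) (k : ℕ) : ℝ :=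
  if h : k < J + 1 then π ⟨k, h⟩ else 0

theorem extendZero_val {J : ℕ} (π : Fin (J + 1) → ℝ) (i : Fin (J + 1)) :
    extendZero π i = π i := by
  rw [extendZero, dif_pos i.2]

theorem IsStationaryDistribution.isReversing {π : Fin (J + 1) → ℝ}
    (hb : ∀ i < J, 0 < birth i) (hd : ∀ i, 1 ≤ i → i ≤ J → 0 < death i)
    (hπ : IsStationaryDistribution (bdGenerator J birth death) π) :
    IsReversing J birth death (extendZero π) := by
  have hbal : ∀ i < J, extendZero π i * birth i = extendZero π (i + 1) * death (i + 1) := by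
    intro j hj
    -- Testing πG = 0 against the indicator of {k > j} leaves only the net flux across the edge from
    -- j to j + 1, which must vanish.
    have h := sum_mul_bdGenerator_mulVec J birth death (extendZero π)
      (fun k => if j < k then 1 else 0)
    simp_rw [extendZero_val] at h
    change π ⬝ᵥ _ = _ at h
    rw [Matrix.dotProduct_mulVec, hπ.balance, zero_dotProduct, Finset.sum_eq_single j] at h
    · simp only [Nat.lt_succ_self, if_true, lt_irrefl, if_false] at h
      linarith
    · intro i _ hij
      by_cases h1 : j < i
      · simp [h1, h1.trans (Nat.lt_succ_self i)]
      · have h2 : ¬ j < i + 1 := by omega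
        simp [h1, h2]
    · intro h1
      exact absurd (Finset.mem_range.2 hj) h1
  have hsum : ∑ i ∈ Finset.range (J + 1), extendZero π i = 1 := by
    rw [← Fin.sum_univ_eq_sum_range]
    simp_rw [extendZero_val]
    exact hπ.sum_eq_one
  have hnonneg : ∀ i, 0 ≤ extendZero π i := by
    intro i
    rw [extendZero]
    split_ifs
    · exact hπ.nonneg _
    · exact le_rfl
  have hpos0 : 0 < extendZero π 0 := by
    refine lt_of_le_of_ne (hnonneg 0) fun h0 => ?_
    have hzero : ∀ i ≤ J, extendZero π i = 0 := by
      intro i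
      induction i with
      | zero => exact fun _ => h0.symm
      | succ i ih =>
        intro hi
        have h1 := hbal i hi
        rw [ih (by omega), zero_mul] at h1
        exact (mul_eq_zero.1 h1.symm).resolve_right (hd (i + 1) (by omega) hi).ne'
    rw [Finset.sum_eq_zero fun i hi => hzero i (Nat.lt_succ_iff.1 (Finset.mem_range.1 hi))] at hsum
    exact zero_ne_one hsum
  refine ⟨fun i => ?_, hsum, hbal⟩
  induction i with
  | zero => exact fun _ => hpos0
  | succ i ih =>
    intro hi
    have h1 := hbal i hi
    have h2 : 0 < extendZero π (i + 1) * death (i + 1) := by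
      rw [← h1]; exact mul_pos (ih (by omega)) (hb i hi)
    exact (pos_iff_pos_of_mul_pos h2).2 (hd (i + 1) (by omega) hi)

/-- The usual product formula. The claim on departures from the queues is given no stationary law,
so one has to be constructed. -/
theorem exists_isReversing (J : ℕ) {birth death : ℕ → ℝ}
    (hb : ∀ i < J, 0 < birth i) (hd : ∀ i, 1 ≤ i → i ≤ J → 0 < death i) :
    ∃ p, IsReversing J birth death p := by
  set q : ℕ → ℝ := fun n => ∏ k ∈ Finset.range n, birth k / death (k + 1) with hq
  have hqpos : ∀ i ≤ J, 0 < q i := fun i hi => Finset.prod_pos fun k hk => by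
    have hk := Finset.mem_range.1 hk
    exact div_pos (hb k (by omega)) (hd (k + 1) (by omega) (by omega))
  have hS : 0 < ∑ i ∈ Finset.range (J + 1), q i :=
    Finset.sum_pos (fun i hi => hqpos i (Nat.lt_succ_iff.1 (Finset.mem_range.1 hi))) (by simp)
  refine ⟨fun i => q i / ∑ i ∈ Finset.range (J + 1), q i, fun i hi => div_pos (hqpos i hi) hS,
    by rw [← Finset.sum_div, div_self hS.ne'], fun i hi => ?_⟩
  have h1 : q (i + 1) = q i * (birth i / death (i + 1)) := Finset.prod_range_succ _ _
  have h2 := (hd (i + 1) (by omega) hi).ne'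
  rw [h1]
  field_simp

/-- The solution of the Poisson equation `G ψ = g - γ` of a birth-death chain, normalized by
`ψ 0 = 0`. -/
noncomputable def poissonSolution (birth p g : ℕ → ℝ) (γ : ℝ) (n : ℕ) : ℝ :=
  ∑ k ∈ Finset.range n, (∑ j ∈ Finset.range (k + 1), p j * (g j - γ)) / (p k * birth k)

/-- Weighting the equation by p and summing up to k telescopes by detailed balance to p_k b_k
(ψ_{k+1} − ψ_k) = T_k, the partial sum in the definition. The equation at the boundary J holds
because centring by γ makes T_J = 0. -/
theorem IsReversing.bdGenerator_mulVec_poissonSolution {p : ℕ → ℝ}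
    (hp : IsReversing J birth death p) (hb : ∀ i < J, 0 < birth i) (g : ℕ → ℝ) {γ : ℝ}
    (hγ : ∑ j ∈ Finset.range (J + 1), p j * g j = γ) (i : Fin (J + 1)) :
    (bdGenerator J birth death *ᵥ fun k => poissonSolution birth p g γ k) i = g i - γ := by
  set T : ℕ → ℝ := fun k => ∑ j ∈ Finset.range (k + 1), p j * (g j - γ) with hT
  have hTJ : T J = 0 := by
    simp only [hT, mul_sub]
    rw [Finset.sum_sub_distrib, hγ, ← Finset.sum_mul, hp.sum_eq_one]
    ring
  have hstep : ∀ k, poissonSolution birth p g γ (k + 1) - poissonSolution birth p g γ k =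
      T k / (p k * birth k) := by
    intro k
    rw [poissonSolution, poissonSolution, Finset.sum_range_succ]
    ring
  rw [bdGenerator_mulVec]
  have hpi := hp.pos i (Nat.lt_succ_iff.1 i.2)
  have h1 : p i * (if (i : ℕ) < J then birth i * (poissonSolution birth p g γ (i + 1) -
      poissonSolution birth p g γ i) else 0) = T i := by
    split_ifs with h
    · rw [hstep]
      have := hb i h
      field_simp
    · have : (i : ℕ) = J := by omega
      rw [this, hTJ, mul_zero]
  have h2 : p i * (if 0 < (i : ℕ) then death i * (poissonSolution birth p g γ (i - 1) -
      poissonSolution birth p g γ i) else 0) = p i * (g i - γ) - T i := by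
    split_ifs with h
    · obtain ⟨k, hk⟩ : ∃ k, (i : ℕ) = k + 1 := ⟨i - 1, by omega⟩
      have hkJ : k < J := by omega
      have hT1 : T (k + 1) = T k + p (k + 1) * (g (k + 1) - γ) := Finset.sum_range_succ _ _
      have h3 := hstep k
      have h4 := hb k hkJ
      have h5 := hp.pos k hkJ.le
      rw [eq_div_iff (by positivity)] at h3
      rw [hk, Nat.add_sub_cancel, hT1, ← mul_assoc, ← hp.balance k hkJ]
      linarith
    · have h0 : (i : ℕ) = 0 := by omega
      rw [h0]
      simp [hT]
  have h3 := congrArg₂ (· + ·) h1 h2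
  rw [← mul_add] at h3
  refine mul_left_cancel₀ hpi.ne' ?_
  rw [h3]
  ring

end BirthDeath

/-! ### The explicit ratio for constant birth rate -/

section ConstantBirthRate

variable {J : ℕ} {lam : ℝ} {death p : ℕ → ℝ}

/-- Detailed balance rewrites p_{j+1} · death_{j+1} as λ p_j, which shifts the index by one. -/
theorem IsReversing.sum_death_mul (hp : IsReversing J (fun _ => lam) death p) (f : ℕ → ℝ) {n : ℕ}
    (hn : n ≤ J) :
    ∑ j ∈ Finset.range (n + 1), p j * (if 0 < j then death j * f (j - 1) else 0) =
      lam * ∑ j ∈ Finset.range n, p j * f j := by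
  rw [Finset.sum_range_succ', Finset.mul_sum]
  simp only [lt_irrefl, if_false, mul_zero, add_zero, Nat.succ_pos, if_true, Nat.add_sub_cancel]
  refine Finset.sum_congr rfl fun j hj => ?_
  have := hp.balance j (by have := Finset.mem_range.1 hj; omega)
  rw [← mul_assoc, ← this]; ring

theorem sum_mul_sub_eq_sum_increments (p f : ℕ → ℝ) (n : ℕ) :
    ∑ i ∈ Finset.range (n + 1), p i * (f n - f i) =
      ∑ k ∈ Finset.range n, (∑ i ∈ Finset.range (k + 1), p i) * (f (k + 1) - f k) := by
  induction n with
  | zero => simp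
  | succ n ih =>
    rw [Finset.sum_range_succ, Finset.sum_range_succ (fun k => (∑ i ∈ Finset.range (k + 1), p i) * (f (k + 1) - f k)), ← ih,
      Finset.sum_mul,
      ← Finset.sum_add_distrib, sub_self, mul_zero, add_zero]
    exact Finset.sum_congr rfl fun i _ => by ring

theorem IsReversing.lt_one (hJ : 1 ≤ J) {birth : ℕ → ℝ} (hp : IsReversing J birth death p) :
    p J < 1 := by
  have h := hp.sum_eq_one
  rw [Finset.sum_range_succ] at h
  have h1 : 0 < ∑ i ∈ Finset.range J, p i :=
    Finset.sum_pos (fun i hi => hp.pos i (Finset.mem_range.1 hi).le) (by simp; omega)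
  linarith

/-- The asymptotic variance-to-mean ratio of the number of deaths in a birth-death process with
constant birth rate. -/
theorem IsReversing.hasAsymptoticRatio {Ω : Type*} [MeasurableSpace Ω] {P : Measure Ω}
    [IsProbabilityMeasure P] {Q : ℝ≥0 → Ω → Fin (J + 1)} (hJ : 1 ≤ J) (hlam : 0 < lam)
    (hp : IsReversing J (fun _ => lam) death p)
    (hQ : IsBirthDeathProcess J (fun _ => lam) death P Q) :
    HasAsymptoticRatio P Q (1 - 2 * (p J / (1 - p J)) * ∑ k ∈ Finset.range (J + 1),
      (∑ i ∈ Finset.range (k + 1), p i) *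
        (1 - p J * ((∑ i ∈ Finset.range (k + 1), p i) / p k))) := by
  set G := bdGenerator J (fun _ => lam) death with hG
  set a := lam * (1 - p J) with ha
  have hpJ := hp.lt_one hJ
  have hapos : 0 < a := mul_pos hlam (by linarith)
  set d : ℕ → ℝ := fun j => if 0 < j then death j else 0 with hd
  have hdsum : ∀ n ≤ J, ∑ j ∈ Finset.range (n + 1), p j * d j =
      lam * ∑ j ∈ Finset.range n, p j := by
    intro n hn
    have h := hp.sum_death_mul (fun _ => 1) hn
    simp only [mul_one] at h
    exact h
  have hsumJ : ∑ j ∈ Finset.range J, p j = 1 - p J := by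
    have := hp.sum_eq_one
    rw [Finset.sum_range_succ] at this
    linarith
  have hda : ∑ j ∈ Finset.range (J + 1), p j * d j = a := by rw [hdsum J le_rfl, hsumJ]
  set f := poissonSolution (fun _ => lam) p d a with hf
  -- The right-hand side of the second Poisson equation before centring; its solution ψ only has to
  -- exist, and just the mean γ of g is computed.
  set g : ℕ → ℝ := fun j => 2 * a * f j + d j - 2 * (if 0 < j then death j * f (j - 1) else 0)
    with hg
  set γ := ∑ j ∈ Finset.range (J + 1), p j * g j with hγ
  have hone : lowerPart G *ᵥ 1 = fun i : Fin (J + 1) => d i := by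
    funext i
    refine (lowerPart_bdGenerator_mulVec J (fun _ => lam) death (fun _ => 1) i).trans ?_
    simp [hd]
  have hratio : HasAsymptoticRatio P Q (γ / a) := by
    refine IsMarkovChainWithGenerator.hasAsymptoticRatio_of_poisson (G := G)
      (f := fun i => f i) (ψ := fun i => poissonSolution (fun _ => lam) p g γ i)
      hQ hapos (bdGenerator_mulVec_one _ _ _) ?_ ?_
    · funext i
      rw [hone, hp.bdGenerator_mulVec_poissonSolution (fun _ _ => hlam) d hda]
      simp
    · funext i
      rw [hone, hp.bdGenerator_mulVec_poissonSolution (fun _ _ => hlam) g hγ.symm]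
      simp only [Pi.sub_apply, Pi.add_apply, Pi.smul_apply, hG, lowerPart_bdGenerator_mulVec]
      simp only [hg, smul_eq_mul, Pi.one_apply, mul_one]
  -- With P_k the partial sums of p, the sum of p_j(d_j − a) over j ≤ k is λ(P_k − p_k) − λ(1 −
  -- p_J)P_k = −λ(p_k − p_J P_k).
  have hincr : ∀ k < J, f (k + 1) - f k =
      -(1 - p J * ((∑ i ∈ Finset.range (k + 1), p i) / p k)) := by
    intro k hk
    have hpk := hp.pos k hk.le
    have h1 : f (k + 1) - f k =
        (∑ j ∈ Finset.range (k + 1), p j * (d j - a)) / (p k * lam) := by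
      rw [hf, poissonSolution, poissonSolution, Finset.sum_range_succ]
      ring
    rw [h1]
    simp only [mul_sub]
    rw [Finset.sum_sub_distrib, hdsum k hk.le, ← Finset.sum_mul, Finset.sum_range_succ, ha]
    field_simp
    ring
  convert hratio using 1
  have hγval : γ = a + 2 * (a * ∑ j ∈ Finset.range (J + 1), p j * f j -
      lam * ∑ j ∈ Finset.range J, p j * f j) := by
    rw [← hp.sum_death_mul f le_rfl, ← hda, hγ, hda, Finset.mul_sum, ← Finset.sum_sub_distrib,
      Finset.mul_sum, ← hda, ← Finset.sum_add_distrib, hda]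
    exact Finset.sum_congr rfl fun j _ => by rw [hg]; ring
  -- The term k = J vanishes, so the sum matches the J increments of f.
  have hlast : 1 - p J * ((∑ i ∈ Finset.range (J + 1), p i) / p J) = 0 := by
    rw [hp.sum_eq_one]
    have := hp.pos J le_rfl
    field_simp
    ring
  have habel := sum_mul_sub_eq_sum_increments p f J
  have hsum : ∑ k ∈ Finset.range (J + 1), (∑ i ∈ Finset.range (k + 1), p i) *
      (1 - p J * ((∑ i ∈ Finset.range (k + 1), p i) / p k)) =
      (∑ j ∈ Finset.range (J + 1), p j * f j) - f J := by
    rw [Finset.sum_range_succ, hlast, mul_zero, add_zero]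
    have h1 : ∑ k ∈ Finset.range J, (∑ i ∈ Finset.range (k + 1), p i) * (f (k + 1) - f k) =
        -∑ k ∈ Finset.range J, (∑ i ∈ Finset.range (k + 1), p i) *
          (1 - p J * ((∑ i ∈ Finset.range (k + 1), p i) / p k)) := by
      rw [← Finset.sum_neg_distrib]
      refine Finset.sum_congr rfl fun k hk => ?_
      rw [hincr k (Finset.mem_range.1 hk)]; ring
    simp only [mul_sub] at habel
    rw [Finset.sum_sub_distrib, ← Finset.sum_mul, hp.sum_eq_one] at habel
    simp only [mul_sub] at h1 ⊢
    linarith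
  have h1 : ∑ j ∈ Finset.range J, p j * f j =
      (∑ j ∈ Finset.range (J + 1), p j * f j) - p J * f J := by
    rw [Finset.sum_range_succ]; ring
  -- Since a = λ(1 − p_J), everything reduces to γ = a − 2λ p_J (∑ p_j f_j − f_J).
  rw [hsum, hγval, h1, ha]
  have h2 : 1 - p J ≠ 0 := by linarith
  field_simp
  ring

/-- With y = p_J P_k / p_k, the k-th summand times p_J is p_k · y(1 − y) ≤ p_k/4. Summing gives at
most 1/4, and 1 − (1/2)/(1 − p_J) is the bound. -/
theorem IsReversing.le_ratio (hJ : 1 ≤ J) {birth : ℕ → ℝ} (hp : IsReversing J birth death p) :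
    (1 / 2 - p J) / (1 - p J) ≤ 1 - 2 * (p J / (1 - p J)) * ∑ k ∈ Finset.range (J + 1),
      (∑ i ∈ Finset.range (k + 1), p i) *
        (1 - p J * ((∑ i ∈ Finset.range (k + 1), p i) / p k)) := by
  have hpJ := hp.lt_one hJ
  have h0 : 0 < 1 - p J := by linarith
  have hle : p J * ∑ k ∈ Finset.range (J + 1), (∑ i ∈ Finset.range (k + 1), p i) *
        (1 - p J * ((∑ i ∈ Finset.range (k + 1), p i) / p k)) ≤ 1 / 4 := by
    calc _ ≤ ∑ k ∈ Finset.range (J + 1), p k * (1 / 4) := by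
          rw [Finset.mul_sum]
          refine Finset.sum_le_sum fun k hk => ?_
          have hpk := hp.pos k (Nat.lt_succ_iff.1 (Finset.mem_range.1 hk))
          set S := ∑ i ∈ Finset.range (k + 1), p i
          have hy : p J * S = p k * (p J * (S / p k)) := by field_simp
          rw [← mul_assoc, hy, mul_assoc]
          refine mul_le_mul_of_nonneg_left ?_ hpk.le
          nlinarith [sq_nonneg (p J * (S / p k) - 1 / 2)]
      _ = 1 / 4 := by rw [← Finset.sum_mul, hp.sum_eq_one, one_mul]
  set S := ∑ k ∈ Finset.range (J + 1), (∑ i ∈ Finset.range (k + 1), p i) *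
        (1 - p J * ((∑ i ∈ Finset.range (k + 1), p i) / p k))
  rw [div_le_iff₀ h0]
  have : (1 - 2 * (p J / (1 - p J)) * S) * (1 - p J) = 1 - p J - 2 * (p J * S) := by
    field_simp
  rw [this]
  linarith

theorem cumulative_eq_sum_range (π : Fin (J + 1) → ℝ) (i : Fin (J + 1)) :
    cumulative π i = ∑ j ∈ Finset.range ((i : ℕ) + 1), extendZero π j := by
  rw [cumulative]
  refine Finset.sum_bij (fun j _ => (j : ℕ)) ?_ ?_ ?_ ?_
  · intro j hj
    have := Fin.le_def.1 (Finset.mem_Iic.1 hj)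
    exact Finset.mem_range.2 (by omega)
  · exact fun j _ k _ h => Fin.ext h
  · intro k hk
    have hk := Finset.mem_range.1 hk
    exact ⟨⟨k, by omega⟩, Finset.mem_Iic.2 (Fin.le_def.2 (by simp; omega)), rfl⟩
  · exact fun j _ => (extendZero_val π j).symm

theorem hasAsymptoticRatio_of_isStationaryDistribution {π : Fin (J + 1) → ℝ} {Ω : Type*}
    [MeasurableSpace Ω] {P : Measure Ω}
    [IsProbabilityMeasure P] {Q : ℝ≥0 → Ω → Fin (J + 1)} (hJ : 1 ≤ J) (hlam : 0 < lam)
    (hd : ∀ i, 1 ≤ i → i ≤ J → 0 < death i)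
    (hπ : IsStationaryDistribution (bdGenerator J (fun _ => lam) death) π)
    (hQ : IsBirthDeathProcess J (fun _ => lam) death P Q) :
    ∃ D : ℝ, HasAsymptoticRatio P Q D ∧
      D = 1 - 2 * (π (Fin.last J) / (1 - π (Fin.last J))) *
        ∑ i, cumulative π i * (1 - π (Fin.last J) * (cumulative π i / π i)) ∧
      (1 / 2 - π (Fin.last J)) / (1 - π (Fin.last J)) ≤ D := by
  have hp := hπ.isReversing (fun _ _ => hlam) hd
  have hlast : extendZero π J = π (Fin.last J) := extendZero_val π (Fin.last J)
  refine ⟨_, hp.hasAsymptoticRatio hJ hlam hQ, ?_, ?_⟩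
  · rw [← Fin.sum_univ_eq_sum_range (fun k => (∑ i ∈ Finset.range (k + 1), extendZero π i) *
      (1 - extendZero π J * ((∑ i ∈ Finset.range (k + 1), extendZero π i) / extendZero π k)))]
    simp_rw [cumulative_eq_sum_range, hlast, extendZero_val]
  · rw [← hlast]
    exact hp.le_ratio hJ

end ConstantBirthRate

/-! ### The full state of an M/M/s/K queue -/

theorem mmskDeath_pos {s : ℕ} (hs : 1 ≤ s) {μ : ℝ} (hμ : 0 < μ) {i : ℕ} (hi : 1 ≤ i) :
    0 < mmskDeath s μ i := by
  have h1 : (0 : ℝ) < (min i s : ℕ) := by exact_mod_cast Nat.lt_min.2 ⟨hi, hs⟩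
  have h2 : (0 : ℝ) < s := by exact_mod_cast hs
  exact mul_pos h1 (div_pos hμ h2)

/-- If the load of an `M/M/s/K` queue is at most `exp x`, then the stationary probability of the
full state is at most `exp (K x) / (K + 1)`. -/
theorem IsReversing.mmsk_full_le {s K : ℕ} (hs : 1 ≤ s) {lam μ x : ℝ} (hμ : 0 < μ)
    {p : ℕ → ℝ} (hp : IsReversing (s + K) (fun _ => lam) (mmskDeath s μ) p) (hx : 0 ≤ x)
    (hload : lam / μ ≤ Real.exp x) : p (s + K) ≤ Real.exp (K * x) / (K + 1) := by
  have hs0 : (s : ℝ) ≠ 0 := by exact_mod_cast (by omega : s ≠ 0)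
  -- From level s on all servers are busy, so the death rate is μ and the ratio of neighbouring
  -- weights is the load.
  have hstep : ∀ k < K, p (s + k + 1) ≤ Real.exp x * p (s + k) := by
    intro k hk
    have h1 := hp.balance (s + k) (by omega)
    have h2 : mmskDeath s μ (s + k + 1) = μ := by
      rw [mmskDeath, min_eq_right (by omega)]; field_simp
    rw [h2] at h1
    have h3 : p (s + k + 1) = lam / μ * p (s + k) := by
      field_simp; linarith
    rw [h3]
    exact mul_le_mul_of_nonneg_right hload (hp.pos _ (by omega)).le
  have hdown : ∀ m ≤ K, p (s + K) ≤ Real.exp x ^ m * p (s + (K - m)) := by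
    intro m
    induction m with
    | zero => intro _; simp
    | succ m ih =>
      intro hm
      refine (ih (by omega)).trans ?_
      have h1 := hstep (K - (m + 1)) (by omega)
      have h2 : s + (K - (m + 1)) + 1 = s + (K - m) := by omega
      rw [h2] at h1
      rw [pow_succ, mul_assoc]
      exact mul_le_mul_of_nonneg_left h1 (by positivity)
  -- Each of the K + 1 states s, …, s + K has at least exp(−Kx) times the weight of the full state;
  -- summing their weights to at most 1 gives the bound.
  have hall : ∀ k ∈ Finset.range (K + 1), p (s + K) ≤ Real.exp (K * x) * p (s + k) := by
    intro k hk
    have hk := Finset.mem_range.1 hk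
    have h1 := hdown (K - k) (by omega)
    have h2 : K - (K - k) = k := by omega
    rw [h2] at h1
    refine h1.trans (mul_le_mul_of_nonneg_right ?_ (hp.pos _ (by omega)).le)
    rw [Real.exp_nat_mul]
    exact pow_le_pow_right₀ (Real.one_le_exp hx) (by omega)
  have hsum := Finset.sum_le_sum hall
  rw [Finset.sum_const, Finset.card_range, ← Finset.mul_sum, nsmul_eq_mul] at hsum
  have hle : ∑ k ∈ Finset.range (K + 1), p (s + k) ≤ 1 := by
    rw [← hp.sum_eq_one, show s + K + 1 = s + (K + 1) by ring, Finset.sum_range_add p s]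
    refine le_add_of_nonneg_left (Finset.sum_nonneg fun i hi => ?_)
    exact (hp.pos i (by have := Finset.mem_range.1 hi; omega)).le
  rw [le_div_iff₀ (by positivity)]
  push_cast at hsum
  calc p (s + K) * (K + 1) ≤ Real.exp (K * x) * ∑ k ∈ Finset.range (K + 1), p (s + k) := by
        linarith
    _ ≤ Real.exp (K * x) * 1 := by gcongr
    _ = _ := mul_one _

/-- The load is at most exp(C/√s) eventually, and K/√s stays below η + 1, so the numerator exp(Kx)
is bounded while K → ∞ because η > 0. -/
theorem tendsto_mmsk_full {β η : ℝ} {s K : ℕ → ℕ} {lam mu : ℕ → ℝ} (hη : 0 < η)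
    (hs : ∀ n, 1 ≤ s n) (hmu : ∀ n, 0 < mu n)
    (hs_top : Tendsto s atTop atTop)
    (hβ : Tendsto (fun n => (1 - lam n / mu n) * Real.sqrt (s n)) atTop (𝓝 β))
    (hK : Tendsto (fun n => (K n : ℝ) / Real.sqrt (s n)) atTop (𝓝 η)) {p : ℕ → ℕ → ℝ}
    (hp : ∀ n, IsReversing (s n + K n) (fun _ => lam n) (mmskDeath (s n) (mu n)) (p n)) :
    Tendsto (fun n => p n (s n + K n)) atTop (𝓝 0) := by
  have hsqrt : Tendsto (fun n => √(s n : ℝ)) atTop atTop :=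
    Real.tendsto_sqrt_atTop.comp (tendsto_natCast_atTop_atTop.comp hs_top)
  have hspos : ∀ n, 0 < √(s n : ℝ) := fun n =>
    Real.sqrt_pos.2 (by exact_mod_cast hs n)
  have hKtop : Tendsto (fun n => (K n : ℝ) + 1) atTop atTop := by
    refine tendsto_atTop_add_const_right _ _ ((hK.pos_mul_atTop hη hsqrt).congr fun n => ?_)
    exact div_mul_cancel₀ _ (hspos n).ne'
  -- Any nonnegative C with −C < β works.
  set C := |β| + 1 with hC
  have hC0 : 0 ≤ C := by positivity
  refine squeeze_zero' (Eventually.of_forall fun n => ((hp n).pos _ le_rfl).le) ?_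
    (hKtop.const_div_atTop (Real.exp ((η + 1) * C)))
  filter_upwards [hβ.eventually (lt_mem_nhds (show -C < β by
    have := neg_abs_le β; linarith)), hK.eventually (gt_mem_nhds (lt_add_one η))] with n h1 h2
  have hload : lam n / mu n ≤ Real.exp (C / √(s n : ℝ)) := by
    refine le_trans ?_ (Real.add_one_le_exp _)
    have h3 : -(C / √(s n : ℝ)) < 1 - lam n / mu n := by
      rw [← neg_div, div_lt_iff₀ (hspos n)]; exact h1
    linarith
  refine ((hp n).mmsk_full_le (hs n) (hmu n) (div_nonneg hC0 (hspos n).le) hload).trans ?_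
  refine div_le_div_of_nonneg_right (Real.exp_le_exp.2 ?_) (by positivity)
  calc (K n : ℝ) * (C / √(s n : ℝ)) = K n / √(s n : ℝ) * C := by ring
    _ ≤ (η + 1) * C := by gcongr

/-! ### Assembly of the two claims -/

theorem mainTheorem2 :
    -- finite birth-death processes with constant birth rate
    (∀ (J : ℕ) (birthRate : ℝ) (death : ℕ → ℝ) (π : Fin (J + 1) → ℝ)
        (Ω : Type*) [MeasurableSpace Ω] (P : Measure Ω) [IsProbabilityMeasure P]
        (Q : ℝ≥0 → Ω → Fin (J + 1)),
      1 ≤ J → 0 < birthRate → (∀ i, 1 ≤ i → i ≤ J → 0 < death i) →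
      IsStationaryDistribution (bdGenerator J (fun _ => birthRate) death) π →
      IsBirthDeathProcess J (fun _ => birthRate) death P Q →
      ∃ D : ℝ, HasAsymptoticRatio P Q D ∧
        D = 1 - 2 * (π (Fin.last J) / (1 - π (Fin.last J))) *
          ∑ i, cumulative π i * (1 - π (Fin.last J) * (cumulative π i / π i)) ∧
        (1 / 2 - π (Fin.last J)) / (1 - π (Fin.last J)) ≤ D) ∧
    -- M/M/s/K queues in the QED regime
    (∀ (β η : ℝ) (s K : ℕ → ℕ) (lam mu : ℕ → ℝ),
      0 < η → (∀ n, 1 ≤ s n) → (∀ n, 0 < lam n) → (∀ n, 0 < mu n) →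
      Tendsto s atTop atTop →
      Tendsto (fun n => (1 - lam n / mu n) * Real.sqrt (s n)) atTop (𝓝 β) →
      Tendsto (fun n => (K n : ℝ) / Real.sqrt (s n)) atTop (𝓝 η) →
      (∀ π : (n : ℕ) → Fin (s n + K n + 1) → ℝ,
        (∀ n, IsStationaryDistribution
          (bdGenerator (s n + K n) (fun _ => lam n) (mmskDeath (s n) (mu n))) (π n)) →
        Tendsto (fun n => π n (Fin.last (s n + K n))) atTop (𝓝 0)) ∧
      (∀ (Ω : ℕ → Type*) [∀ n, MeasurableSpace (Ω n)] (P : (n : ℕ) → Measure (Ω n))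
          [∀ n, IsProbabilityMeasure (P n)]
          (Q : (n : ℕ) → ℝ≥0 → Ω n → Fin (s n + K n + 1)),
        (∀ n, IsBirthDeathProcess (s n + K n) (fun _ => lam n) (mmskDeath (s n) (mu n))
          (P n) (Q n)) →
        ∃ D : ℕ → ℝ, (∀ n, HasAsymptoticRatio (P n) (Q n) (D n)) ∧
          -- the lower limit of `D` is at least `1 / 2`
          (∀ c : ℝ, c < 1 / 2 → ∀ᶠ n in atTop, c < D n) ∧
          -- hence so is the limit, for every value it may have
          (∀ Dlim : ℝ, Tendsto D atTop (𝓝 Dlim) → 1 / 2 ≤ Dlim))) := by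
  refine ⟨fun J lam death π Ω _ P _ Q hJ hlam hd hπ hQ =>
    hasAsymptoticRatio_of_isStationaryDistribution hJ hlam hd hπ hQ, ?_⟩
  intro β η s K lam mu hη hs hlam hmu hs_top hβ hK
  have hdeath : ∀ n i, 1 ≤ i → i ≤ s n + K n → 0 < mmskDeath (s n) (mu n) i :=
    fun n i hi _ => mmskDeath_pos (hs n) (hmu n) hi
  refine ⟨fun π hπ => ?_, fun Ω _ P _ Q hQ => ?_⟩
  · have h := tendsto_mmsk_full hη hs hmu hs_top hβ hK
      fun n => (hπ n).isReversing (fun _ _ => hlam n) (hdeath n)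
    exact h.congr fun n => extendZero_val (π n) (Fin.last _)
  · have hJ : ∀ n, 1 ≤ s n + K n := fun n => (hs n).trans (Nat.le_add_right _ _)
    choose p hp using fun n => exists_isReversing (s n + K n) (fun _ _ => hlam n) (hdeath n)
    have hzero := tendsto_mmsk_full hη hs hmu hs_top hβ hK hp
    have hlower : Tendsto (fun n => (1 / 2 - p n (s n + K n)) / (1 - p n (s n + K n))) atTop
        (𝓝 (1 / 2)) := by
      have h := (hzero.const_sub (1 / 2)).div (hzero.const_sub 1) (by norm_num)
      rw [sub_zero, sub_zero, div_one] at h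
      exact h
    have hle := fun n => (hp n).le_ratio (hJ n)
    refine ⟨_, fun n => (hp n).hasAsymptoticRatio (hJ n) (hlam n) (hQ n), fun c hc => ?_,
      fun Dlim hD => le_of_tendsto_of_tendsto' hlower hD hle⟩
    filter_upwards [hlower.eventually (lt_mem_nhds hc)] with n hn using hn.trans_le (hle n)
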